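/- Work in the language of second order arithmetic. A \emph{tree} is a set $T$ of (codes of) finite sequences of natural numbers closed under initial segments; a \emph{path} through $T$ is a function $\Lambda:\mathbb N\to\mathbb N$ all of whose finite initial segments belong to $T$; $T$ is \emph{ill-founded} if it has a path. For $\Lambda',\Lambda:\mathbb N\to\mathbb N$, $\Lambda'$ is \emph{to the left of} $\Lambda$ if for some $n$ we have $\Lambda'(i)=\Lambda(i)$ for all $i<n$ and $\Lambda'(n)<\Lambda(n)$. The \emph{$\Sigma_0$-relative leftmost path principle} $\Sigma_0$-LPP states: for every ill-founded tree $T$ there is a path $\Lambda$ through $T$ such that no path $\Lambda'$ through $T$ which is computable in $T\oplus\Lambda$ is to the left of $\Lambda$. (In a model of $\mathsf{RCA}_0$, "$W$ is computable in $Z$" means that $W$ is $\Delta^0_1$ definable in the model from the set parameter $Z$ and number parameters of the model, i.e. has a possibly nonstandard index relative to $Z$.) For a relation $\prec$ and a set $Y$ let $(Y)^j=\{(m,i)\in Y\mid i\prec j\}$. $\mathsf{ATR}_0$ is $\mathsf{ACA}_0$ together with, for each formula $\theta(x,X,\vec z,\vec Z)$ without set quantifiers, the axiom $$\forall \vec z\,\forall\vec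 Z\,\forall\prec\ \bigl(\mathrm{WO}(\prec)\rightarrow\exists Y\,\forall j\in\mathrm{field}(\prec)\,\forall x\,[(x,j)\in Y\leftrightarrow\theta(x,(Y)^j,\vec z,\vec Z)]\bigr),$$ where $\mathrm{WO}(\prec)$ says that $\prec$ is a strict linear ordering of its field without infinite descending sequences. \textbf{Theorem.} Over $\mathsf{RCA}_0$, $\Sigma_0$-LPP implies $\mathsf{ATR}_0$. That is, every model (not necessarily an $\omega$-model) of $\mathsf{RCA}_0$ in which $\Sigma_0$-LPP holds is a model of $\mathsf{ATR}_0$ (in particular of $\mathsf{ACA}_0$). -/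

import Mathlib

/-!
Second order arithmetic and its models in the usual (Henkin) sense.  The number part of a model may
be nonstandard and its set part is an arbitrary family of subsets of the number part.  A set of
pairs, a function, a finite sequence and a tree are coded by numbers and sets of the model, as is
customary in reverse mathematics.
-/

universe u

namespace SOA

/-! ### Syntax: arithmetical formulas -/

/-- Number terms of the language of second order arithmetic, with number variables `v₀, v₁, …`. -/
inductive NumTerm : Type
  | var (i : ℕ) : NumTerm
  | zero : NumTerm
  | one : NumTerm
  | add (s t : NumTerm) : NumTerm
  | mul (s t : NumTerm) : NumTerm

/-- Arithmetical formulas, i.e. formulas without set quantifiers; free set variables `X₀, X₁, …` are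
allowed.  Number quantifiers bind the variable `v₀` of their body and shift the other number
variables by one.  In the bounded quantifiers `ball t φ` (`∀ v < t, φ`) and `bex t φ` (`∃ v < t, φ`)
the bound `t` lies outside the scope of the quantifier. -/
inductive ArithFormula : Type
  | eq (s t : NumTerm) : ArithFormula
  | lt (s t : NumTerm) : ArithFormula
  | mem (t : NumTerm) (k : ℕ) : ArithFormula
  | neg (φ : ArithFormula) : ArithFormula
  | and (φ ψ : ArithFormula) : ArithFormula
  | or (φ ψ : ArithFormula) : ArithFormula
  | ball (t : NumTerm) (φ : ArithFormula) : ArithFormula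
  | bex (t : NumTerm) (φ : ArithFormula) : ArithFormula
  | all (φ : ArithFormula) : ArithFormula
  | ex (φ : ArithFormula) : ArithFormula

namespace ArithFormula

/-- `Σ⁰₀` formulas: all quantifiers are bounded. -/
def IsBounded : ArithFormula → Prop
  | eq _ _ => True
  | lt _ _ => True
  | mem _ _ => True
  | neg φ => φ.IsBounded
  | and φ ψ => φ.IsBounded ∧ ψ.IsBounded
  | or φ ψ => φ.IsBounded ∧ ψ.IsBounded
  | ball _ φ => φ.IsBounded
  | bex _ φ => φ.IsBounded
  | all _ => False
  | ex _ => False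

/-- `Σ⁰₁` formulas `∃ v, θ` with `θ` a `Σ⁰₀` formula. -/
def IsSigma1 (φ : ArithFormula) : Prop := ∃ θ : ArithFormula, θ.IsBounded ∧ φ = ex θ

/-- `Π⁰₁` formulas `∀ v, θ` with `θ` a `Σ⁰₀` formula. -/
def IsPi1 (φ : ArithFormula) : Prop := ∃ θ : ArithFormula, θ.IsBounded ∧ φ = all θ

end ArithFormula

/-! ### Semantics -/

/-- A structure for the language of second order arithmetic: a set of numbers with `0, 1, +, ·, <`
and a nonempty family of subsets of it over which the set variables range. -/
structure L2Structure where
  Num : Type u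
  zero : Zero Num
  one : One Num
  add : Add Num
  mul : Mul Num
  lt : LT Num
  sets : Set (Set Num)
  sets_nonempty : sets.Nonempty

attribute [instance] L2Structure.zero L2Structure.one L2Structure.add L2Structure.mul L2Structure.lt

/-- Put `a` in front of the assignment `ρ`. -/
def cons {A : Type u} (a : A) (ρ : ℕ → A) : ℕ → A
  | 0 => a
  | n + 1 => ρ n

namespace L2Structure

variable (M : L2Structure.{u})

/-- Value of a term under the assignment `ρ` of the number variables. -/
def termVal (ρ : ℕ → M.Num) : NumTerm → M.Num
  | .var i => ρ i
  | .zero => 0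
  | .one => 1
  | .add s t => termVal ρ s + termVal ρ t
  | .mul s t => termVal ρ s * termVal ρ t

/-- Truth of an arithmetical formula in `M` under the assignments `ρ` of the number variables and
`Z` of the set variables. -/
def Sat (Z : ℕ → Set M.Num) : (ℕ → M.Num) → ArithFormula → Prop
  | ρ, .eq s t => M.termVal ρ s = M.termVal ρ t
  | ρ, .lt s t => M.termVal ρ s < M.termVal ρ t
  | ρ, .mem t k => M.termVal ρ t ∈ Z k
  | ρ, .neg φ => ¬ Sat Z ρ φ
  | ρ, .and φ ψ => Sat Z ρ φ ∧ Sat Z ρ ψ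
  | ρ, .or φ ψ => Sat Z ρ φ ∨ Sat Z ρ ψ
  | ρ, .ball t φ => ∀ a : M.Num, a < M.termVal ρ t → Sat Z (cons a ρ) φ
  | ρ, .bex t φ => ∃ a : M.Num, a < M.termVal ρ t ∧ Sat Z (cons a ρ) φ
  | ρ, .all φ => ∀ a : M.Num, Sat Z (cons a ρ) φ
  | ρ, .ex φ => ∃ a : M.Num, Sat Z (cons a ρ) φ

/-- The basic axioms of second order arithmetic. -/
structure BasicAxioms : Prop where
  succ_ne_zero : ∀ n : M.Num, n + 1 ≠ 0
  succ_inj : ∀ m n : M.Num, m + 1 = n + 1 → m = n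
  add_zero : ∀ m : M.Num, m + 0 = m
  add_succ : ∀ m n : M.Num, m + (n + 1) = (m + n) + 1
  mul_zero : ∀ m : M.Num, m * 0 = 0
  mul_succ : ∀ m n : M.Num, m * (n + 1) = m * n + m
  not_lt_zero : ∀ m : M.Num, ¬ m < 0
  lt_succ : ∀ m n : M.Num, m < n + 1 ↔ m < n ∨ m = n

/-- The induction axiom for sets. -/
def SetInduction : Prop :=
  ∀ X ∈ M.sets, 0 ∈ X → (∀ n, n ∈ X → n + 1 ∈ X) → ∀ n, n ∈ X

/-- `Σ⁰₁` induction, with number and set parameters from `M`. -/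
def Sigma1Induction : Prop :=
  ∀ φ : ArithFormula, φ.IsSigma1 → ∀ (ρ : ℕ → M.Num) (Z : ℕ → Set M.Num), (∀ k, Z k ∈ M.sets) →
    M.Sat Z (cons 0 ρ) φ → (∀ n, M.Sat Z (cons n ρ) φ → M.Sat Z (cons (n + 1) ρ) φ) →
      ∀ n, M.Sat Z (cons n ρ) φ

/-- `Δ⁰₁` comprehension, with number and set parameters from `M`. -/
def Delta1Comprehension : Prop :=
  ∀ φ ψ : ArithFormula, φ.IsSigma1 → ψ.IsPi1 →
    ∀ (ρ : ℕ → M.Num) (Z : ℕ → Set M.Num), (∀ k, Z k ∈ M.sets) →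
      (∀ n, M.Sat Z (cons n ρ) φ ↔ M.Sat Z (cons n ρ) ψ) →
        ∃ X ∈ M.sets, ∀ n, n ∈ X ↔ M.Sat Z (cons n ρ) φ

/-- Arithmetical comprehension, with number and set parameters from `M`. -/
def ArithComprehension : Prop :=
  ∀ (φ : ArithFormula) (ρ : ℕ → M.Num) (Z : ℕ → Set M.Num), (∀ k, Z k ∈ M.sets) →
    ∃ X ∈ M.sets, ∀ n, n ∈ X ↔ M.Sat Z (cons n ρ) φ

/-- `M` is a model of `RCA₀`. -/
structure RCA0 : Prop where
  basic : M.BasicAxioms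
  induction : M.Sigma1Induction
  comprehension : M.Delta1Comprehension

/-- `M` is a model of `ACA₀`. -/
structure ACA0 : Prop where
  basic : M.BasicAxioms
  induction : M.SetInduction
  comprehension : M.ArithComprehension

variable {M}

/-! ### Pairs, relations, functions -/

/-- `p` is the code of the pair `(i, j)`: the Cantor pairing `p = (i + j)(i + j + 1) / 2 + i`. -/
def IsPair (i j p : M.Num) : Prop := p + p = (i + j) * (i + j + 1) + (i + i)

/-- `(i, j) ∈ X`. -/
def PairMem (X : Set M.Num) (i j : M.Num) : Prop := ∃ p, IsPair i j p ∧ p ∈ X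

/-- An infinite sequence of `M`, i.e. a function of `M` from numbers to numbers, given by its graph:
`(i, v) ∈ F` means `F(i) = v`. -/
def IsFun (F : Set M.Num) : Prop := F ∈ M.sets ∧ ∀ i, ∃! v, PairMem F i v

/-- The field of a binary relation. -/
def field (R : Set M.Num) : Set M.Num := {x | ∃ y, PairMem R x y ∨ PairMem R y x}

/-- `R` is a (strict) linear ordering of its field. -/
structure IsLinearOrdering (R : Set M.Num) : Prop where
  mem_sets : R ∈ M.sets
  trans : ∀ x y z, PairMem R x y → PairMem R y z → PairMem R x z
  irrefl : ∀ x, ¬ PairMem R x x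
  total : ∀ x ∈ field R, ∀ y ∈ field R, PairMem R x y ∨ x = y ∨ PairMem R y x

/-- `M ⊨ WO(R)`: `R` is a linear ordering and `M` contains no infinite `R`-descending sequence. -/
def WO (R : Set M.Num) : Prop :=
  IsLinearOrdering R ∧
    ¬ ∃ F : Set M.Num, IsFun F ∧
      ∀ i a b, PairMem F i a → PairMem F (i + 1) b → PairMem R b a

/-! ### Finite sequences

The number `s = (l, (m, n))` codes the sequence of length `l` whose `i`-th entry, for `i < l`, is the
remainder of `n` modulo `(i + 1) m + 1` (Gödel's beta function).  The finite sequence is identified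
with its least code. -/

/-- The sequence coded by `s` has length `l`. -/
def Len (s l : M.Num) : Prop := ∃ b, IsPair l b s

/-- The `i`-th entry of the sequence coded by `s` exists and equals `v`. -/
def Entry (s i v : M.Num) : Prop :=
  ∃ l m n b, IsPair m n b ∧ IsPair l b s ∧ i < l ∧
    v < (i + 1) * m + 1 ∧ ∃ q, n = q * ((i + 1) * m + 1) + v

/-- `s` and `t` code the same finite sequence. -/
def SameSeq (s t : M.Num) : Prop :=
  (∀ l, Len s l ↔ Len t l) ∧ ∀ i v, Entry s i v ↔ Entry t i v

/-- `s` is (the least code of) a finite sequence. -/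
def IsSeq (s : M.Num) : Prop := ∀ t, SameSeq s t → ¬ t < s

/-- `s ⊑ t` for finite sequences. -/
def Prefix (s t : M.Num) : Prop := ∀ i v, Entry s i v → Entry t i v

/-- `s` is the restriction of the infinite sequence `F` to the numbers below `n`. -/
def IsRestriction (F : Set M.Num) (n s : M.Num) : Prop :=
  IsSeq s ∧ Len s n ∧ ∀ i v, Entry s i v → PairMem F i v

/-! ### Trees and paths -/

/-- A tree of `M`: a set of finite sequences closed under initial segments. -/
structure IsTree (T : Set M.Num) : Prop where
  mem_sets : T ∈ M.sets
  isSeq : ∀ s ∈ T, IsSeq s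
  closed : ∀ s ∈ T, ∀ t, IsSeq t → Prefix t s → t ∈ T

/-- `F` is an infinite path of `M` through `T`. -/
def IsPath (T F : Set M.Num) : Prop := IsFun F ∧ ∀ n, ∃ s ∈ T, IsRestriction F n s

/-- `T` is ill-founded in `M`. -/
def IllFounded (T : Set M.Num) : Prop := ∃ F, IsPath T F

/-- `F` is (strictly) to the left of `G`: for some `n` the sequences agree below `n`, and
`F(n) < G(n)`. -/
def LeftOf (F G : Set M.Num) : Prop :=
  ∃ n, (∀ i, i < n → ∀ v, PairMem F i v ↔ PairMem G i v) ∧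
    ∃ a b, PairMem F n a ∧ PairMem G n b ∧ a < b

/-- `X ⊕ Y = {2n : n ∈ X} ∪ {2n + 1 : n ∈ Y}`. -/
def join (X Y : Set M.Num) : Set M.Num :=
  {x | (∃ n ∈ X, x = n + n) ∨ ∃ n ∈ Y, x = n + n + 1}

/-- `W` is computable in `Z`, in the sense of `M`: `W` is `Δ⁰₁` definable in `M` from the only set
parameter `Z` and from number parameters of `M`. -/
def ComputableIn (W Z : Set M.Num) : Prop :=
  ∃ φ ψ : ArithFormula, φ.IsSigma1 ∧ ψ.IsPi1 ∧ ∃ ρ : ℕ → M.Num, ∀ n,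
    (n ∈ W ↔ M.Sat (fun _ => Z) (cons n ρ) φ) ∧ (n ∈ W ↔ M.Sat (fun _ => Z) (cons n ρ) ψ)

variable (M)

/-- The `Σ₀`-relative leftmost path principle holds in `M`: every ill-founded tree `T` has a path `F`
such that no path through `T` that is computable in `T ⊕ F` is to the left of `F`. -/
def Sigma0LPP : Prop :=
  ∀ T : Set M.Num, IsTree T → IllFounded T →
    ∃ F, IsPath T F ∧
      ¬ ∃ G, IsPath T G ∧ ComputableIn G (join T F) ∧ LeftOf G F

variable {M}

/-! ### Arithmetical transfinite recursion -/

/-- `(Y)^j = {(m, i) ∈ Y : i ≺ j}`, where `≺` is the relation `R`. -/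
def below (R Y : Set M.Num) (j : M.Num) : Set M.Num :=
  {p | p ∈ Y ∧ ∃ m i, IsPair m i p ∧ PairMem R i j}

/-- `H_θ(R, Y)`: for all `j` in the field of `R`, `{x : (x, j) ∈ Y} = {x : θ(x, (Y)^j)}`.  In `θ` the
number variable `v₀` stands for `x`, the set variable `X₀` for `(Y)^j`; the other variables are the
parameters, with values `ρ` and `Z`. -/
def H (θ : ArithFormula) (ρ : ℕ → M.Num) (Z : ℕ → Set M.Num) (R Y : Set M.Num) : Prop :=
  ∀ j ∈ field R, ∀ x, PairMem Y x j ↔ M.Sat (cons (below R Y j) Z) (cons x ρ) θ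

variable (M)

/-- The scheme of arithmetical transfinite recursion, with number and set parameters from `M`. -/
def ArithTransfiniteRecursion : Prop :=
  ∀ (θ : ArithFormula) (ρ : ℕ → M.Num) (Z : ℕ → Set M.Num), (∀ k, Z k ∈ M.sets) →
    ∀ R : Set M.Num, WO R → ∃ Y ∈ M.sets, H θ ρ Z R Y

/-- `M` is a model of `ATR₀`. -/
structure ATR0 : Prop where
  aca : M.ACA0
  recursion : M.ArithTransfiniteRecursion

end L2Structure

end SOA

/-!
The proof applies the leftmost path principle once for each hierarchy that has to be built, to a
tree whose paths *claim* to describe the hierarchy.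

Let `Y` be the hierarchy to be built: level `j` of `Y` is `Σ⁰₁` in the part of `Y` on the levels
preceding `j`, with a matrix `B` (`IsMatrix`). A *record* (`IsRecord`) is a function which has a
position for every number `q`, where the value `0` is the claim that `q` does not belong to `Y`.
Whoever makes this claim has to support it at later positions by writing down the hierarchy below
the level of `q`, together with witnesses for its elements. That the support is as required is a
`Π⁰₁` condition, hence the records are the paths of a tree (`exists_tree`), and there is a record
without any claims (`IsMatrix.exists_record`). Let `f` be a leftmost record in the sense of the
principle, and let `present f` be the set of all `q` that `f` does not claim to be absent. Along a
relation with transfinite induction for arithmetical predicates, `present f` is correct on all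
levels. For if it is correct below the level of `q`, then

* the support of a claim that `q` is absent is forced to agree with `present f`, so that the claim
  is true (`IsRecord.claimSet_eq`);
* if `q` ought to be absent but `f` does not claim so, one passes to the record that makes the claim
  and supports it by `present f` with least witnesses, dropping all later claims. It is computable
  from `f` and to the left of `f` (`IsRecord.exists_competitor`), which is impossible.

This is `IsMatrix.exists_hierarchy`. It is used twice. For the empty relation it yields `Σ⁰₁`
comprehension, and therefore `ACA₀` (`Sigma0LPP.aca0`); no transfinite induction is needed there.
In `ACA₀`, well-orderings satisfy transfinite induction for arithmetical predicates
(`ACA0.arithInduction_lexPrec`), and then the recursion for an arithmetical formula `θ` along a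
well-ordering `R` is a `Σ⁰₁` recursion along the lexicographic product of `R` with the numbers: on
the levels `(j, m)`, with `m` the code of a subformula of `θ`, the truth of this subformula at stage
`j` is determined from the truth of its immediate subformulas and of `θ` at earlier stages
(`mem_truthCode_iff`).

As the model need not be an `ω`-model, its arithmetic is developed from `Σ⁰₁` induction: the numbers
form an ordered commutative semiring, and finite sequences are obtained by the Chinese remainder
theorem (`exists_code`). Definability is treated semantically. `Df b 𝒵 P` says that the predicate
`P` on assignments is definable, by a bounded formula if `b = true`, from sets in `𝒵`; instances for
the logical operations and for substitution of term-bounded functions reduce definability proofs to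
instance search.
-/

namespace SOA

/-! ### Definable predicates -/

/-- Extend a renaming of number variables below a quantifier. -/
def liftRen (f : ℕ → ℕ) : ℕ → ℕ
  | 0 => 0
  | n + 1 => f n + 1

theorem cons_comp_liftRen {A : Type u} (a : A) (ρ : ℕ → A) (f : ℕ → ℕ) :
    cons a ρ ∘ liftRen f = cons a (ρ ∘ f) := by
  funext n
  cases n <;> rfl

/-- Rename the number variables of a term. -/
def NumTerm.ren (f : ℕ → ℕ) : NumTerm → NumTerm
  | var i => var (f i)
  | zero => zero
  | one => one
  | add s t => add (s.ren f) (t.ren f)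
  | mul s t => mul (s.ren f) (t.ren f)

/-- Rename the set variables of a formula by `g` and its free number variables by `f`. -/
def ArithFormula.ren (g : ℕ → ℕ) : (ℕ → ℕ) → ArithFormula → ArithFormula
  | f, eq s t => eq (s.ren f) (t.ren f)
  | f, lt s t => lt (s.ren f) (t.ren f)
  | f, mem t k => mem (t.ren f) (g k)
  | f, neg φ => neg (φ.ren g f)
  | f, and φ ψ => and (φ.ren g f) (ψ.ren g f)
  | f, or φ ψ => or (φ.ren g f) (ψ.ren g f)
  | f, ball t φ => ball (t.ren f) (φ.ren g (liftRen f))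
  | f, bex t φ => bex (t.ren f) (φ.ren g (liftRen f))
  | f, all φ => all (φ.ren g (liftRen f))
  | f, ex φ => ex (φ.ren g (liftRen f))

theorem ArithFormula.IsBounded.ren {φ : ArithFormula} (h : φ.IsBounded) (g f : ℕ → ℕ) :
    (φ.ren g f).IsBounded := by
  induction φ generalizing f with
  | eq | lt | mem => trivial
  | neg φ ih => exact ih h f
  | and φ ψ ih₁ ih₂ => exact ⟨ih₁ h.1 f, ih₂ h.2 f⟩
  | or φ ψ ih₁ ih₂ => exact ⟨ih₁ h.1 f, ih₂ h.2 f⟩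
  | ball t φ ih => exact ih h _
  | bex t φ ih => exact ih h _
  | all φ => exact h.elim
  | ex φ => exact h.elim

namespace L2Structure

variable {M : L2Structure.{u}}

theorem termVal_ren (ρ : ℕ → M.Num) (f : ℕ → ℕ) (t : NumTerm) :
    M.termVal ρ (t.ren f) = M.termVal (ρ ∘ f) t := by
  induction t with
  | var | zero | one => rfl
  | add s t ih₁ ih₂ => simp only [NumTerm.ren, termVal, ih₁, ih₂]
  | mul s t ih₁ ih₂ => simp only [NumTerm.ren, termVal, ih₁, ih₂]

theorem sat_ren (Z : ℕ → Set M.Num) (g f : ℕ → ℕ) (ρ : ℕ → M.Num) (φ : ArithFormula) :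
    M.Sat Z ρ (φ.ren g f) ↔ M.Sat (Z ∘ g) (ρ ∘ f) φ := by
  induction φ generalizing f ρ with
  | eq s t => simp only [ArithFormula.ren, Sat, termVal_ren]
  | lt s t => simp only [ArithFormula.ren, Sat, termVal_ren]
  | mem t k => simp only [ArithFormula.ren, Sat, termVal_ren, Function.comp]
  | neg φ ih => simp only [ArithFormula.ren, Sat, ih]
  | and φ ψ ih₁ ih₂ => simp only [ArithFormula.ren, Sat, ih₁, ih₂]
  | or φ ψ ih₁ ih₂ => simp only [ArithFormula.ren, Sat, ih₁, ih₂]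
  | ball t φ ih => simp only [ArithFormula.ren, Sat, ih, termVal_ren, cons_comp_liftRen]
  | bex t φ ih => simp only [ArithFormula.ren, Sat, ih, termVal_ren, cons_comp_liftRen]
  | all φ ih => simp only [ArithFormula.ren, Sat, ih, cons_comp_liftRen]
  | ex φ ih => simp only [ArithFormula.ren, Sat, ih, cons_comp_liftRen]

/-- The assignment that gives the `i`-th variable either the value of a variable under `ρ` or a
constant, as `r i` prescribes. -/
def env (r : ℕ → ℕ ⊕ M.Num) (ρ : ℕ → M.Num) : ℕ → M.Num := fun i => Sum.elim ρ id (r i)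

/-- Interleave two prescriptions for assignments. -/
def merge {A : Type*} (r s : ℕ → A) : ℕ → A := fun i => if i % 2 = 0 then r (i / 2) else s (i / 2)

theorem merge_even {A : Type*} (r s : ℕ → A) : merge r s ∘ (fun i => 2 * i) = r := by
  funext i
  simp [merge]

theorem merge_odd {A : Type*} (r s : ℕ → A) : merge r s ∘ (fun i => 2 * i + 1) = s := by
  funext i
  have h : (2 * i + 1) / 2 = i := by omega
  simp [merge, Nat.add_mod, h]

theorem env_merge_even (r s : ℕ → ℕ ⊕ M.Num) (ρ : ℕ → M.Num) :
    env (merge r s) ρ ∘ (fun i => 2 * i) = env r ρ := by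
  funext i
  exact congrArg (Sum.elim ρ id) (congrFun (merge_even r s) i)

theorem env_merge_odd (r s : ℕ → ℕ ⊕ M.Num) (ρ : ℕ → M.Num) :
    env (merge r s) ρ ∘ (fun i => 2 * i + 1) = env s ρ := by
  funext i
  exact congrArg (Sum.elim ρ id) (congrFun (merge_odd r s) i)

/-- The renaming that collects the occurrences of the variable `0` in the prescription `r`. -/
def bindRen (r : ℕ → ℕ ⊕ M.Num) (i : ℕ) : ℕ :=
  match r i with
  | .inl 0 => 0
  | _ => i + 1

/-- The prescription `r` with all variables lowered by one. -/
def bindEnv (r : ℕ → ℕ ⊕ M.Num) (i : ℕ) : ℕ ⊕ M.Num :=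
  match r i with
  | .inl n => .inl (n - 1)
  | .inr c => .inr c

theorem cons_env_comp_bindRen (r : ℕ → ℕ ⊕ M.Num) (a : M.Num) (ρ : ℕ → M.Num) :
    cons a (env (bindEnv r) ρ) ∘ bindRen r = env r (cons a ρ) := by
  funext i
  simp only [Function.comp, bindRen, env]
  rcases h : r i with (_ | n) | c
  · rfl
  · simp [cons, env, bindEnv, h]
  · simp [cons, env, bindEnv, h]

variable (M) in
/-- `f` is given by a term of the language with number parameters from `M`. -/
class Tm (f : (ℕ → M.Num) → M.Num) : Prop where
  exists_term : ∃ (t : NumTerm) (r : ℕ → ℕ ⊕ M.Num), ∀ ρ, f ρ = M.termVal (env r ρ) t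

/-- `P` is defined by a formula with set parameters from `𝒵` and number parameters from `M`; if
`b = true`, the formula is required to be bounded. -/
class Df (b : Bool) (𝒵 : Set (Set M.Num)) (P : (ℕ → M.Num) → Prop) : Prop where
  exists_formula : ∃ (φ : ArithFormula) (Z : ℕ → Set M.Num) (r : ℕ → ℕ ⊕ M.Num),
    (b = true → φ.IsBounded) ∧ (∀ k, Z k ∈ 𝒵) ∧ ∀ ρ, P ρ ↔ M.Sat Z (env r ρ) φ

/-- The set `S` is definable from sets in `𝒵`; if `b = true`, by a bounded formula. -/
class SetDf (b : Bool) (𝒵 : Set (Set M.Num)) (S : Set M.Num) : Prop where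
  df : Df b 𝒵 fun ρ => ρ 0 ∈ S

instance : Nonempty M.sets := M.sets_nonempty.to_subtype

instance Tm.var (i : ℕ) : Tm M fun ρ => ρ i := ⟨.var i, .inl, fun _ => rfl⟩

instance Tm.const (c : M.Num) : Tm M fun _ => c := ⟨.var 0, fun _ => .inr c, fun _ => rfl⟩

instance Tm.add (f g : (ℕ → M.Num) → M.Num) [hf : Tm M f] [hg : Tm M g] :
    Tm M fun ρ => f ρ + g ρ := by
  obtain ⟨s, r₁, hs⟩ := hf
  obtain ⟨t, r₂, ht⟩ := hg
  refine ⟨.add (s.ren fun i => 2 * i) (t.ren fun i => 2 * i + 1), merge r₁ r₂, fun ρ => ?_⟩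
  simp only [termVal, termVal_ren, env_merge_even, env_merge_odd, hs, ht]

instance Tm.mul (f g : (ℕ → M.Num) → M.Num) [hf : Tm M f] [hg : Tm M g] :
    Tm M fun ρ => f ρ * g ρ := by
  obtain ⟨s, r₁, hs⟩ := hf
  obtain ⟨t, r₂, ht⟩ := hg
  refine ⟨.mul (s.ren fun i => 2 * i) (t.ren fun i => 2 * i + 1), merge r₁ r₂, fun ρ => ?_⟩
  simp only [termVal, termVal_ren, env_merge_even, env_merge_odd, hs, ht]

theorem Tm.shift {f : (ℕ → M.Num) → M.Num} (hf : Tm M f) : Tm M fun ρ => f fun n => ρ (n + 1) := by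
  obtain ⟨t, r, ht⟩ := hf
  refine ⟨t, fun i => (r i).map (· + 1) id, fun ρ => ?_⟩
  rw [ht]
  congr 1
  funext i
  simp only [env]
  rcases r i <;> rfl

section Df

variable {b : Bool} {𝒵 : Set (Set M.Num)}

theorem Df.of_iff {Q : (ℕ → M.Num) → Prop} (P : (ℕ → M.Num) → Prop) [hP : Df b 𝒵 P]
    (h : ∀ ρ, Q ρ ↔ P ρ) : Df b 𝒵 Q := by
  obtain ⟨φ, Z, r, h₁, h₂, h₃⟩ := hP
  exact ⟨φ, Z, r, h₁, h₂, fun ρ => (h ρ).trans (h₃ ρ)⟩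

theorem Df.eq_of_tm [hZ : Nonempty 𝒵] {f g : (ℕ → M.Num) → M.Num} (hf : Tm M f) (hg : Tm M g) :
    Df b 𝒵 fun ρ => f ρ = g ρ := by
  obtain ⟨s, r₁, hs⟩ := hf
  obtain ⟨t, r₂, ht⟩ := hg
  obtain ⟨A, hA⟩ := hZ
  refine ⟨.eq (s.ren fun i => 2 * i) (t.ren fun i => 2 * i + 1), fun _ => A, merge r₁ r₂,
    fun _ => trivial, fun _ => hA, fun ρ => ?_⟩
  simp only [Sat, termVal_ren, env_merge_even, env_merge_odd, hs, ht]

theorem Df.lt_of_tm [hZ : Nonempty 𝒵] {f g : (ℕ → M.Num) → M.Num} (hf : Tm M f) (hg : Tm M g) :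
    Df b 𝒵 fun ρ => f ρ < g ρ := by
  obtain ⟨s, r₁, hs⟩ := hf
  obtain ⟨t, r₂, ht⟩ := hg
  obtain ⟨A, hA⟩ := hZ
  refine ⟨.lt (s.ren fun i => 2 * i) (t.ren fun i => 2 * i + 1), fun _ => A, merge r₁ r₂,
    fun _ => trivial, fun _ => hA, fun ρ => ?_⟩
  simp only [Sat, termVal_ren, env_merge_even, env_merge_odd, hs, ht]

theorem Df.mem_of_tm {f : (ℕ → M.Num) → M.Num} (hf : Tm M f) {S : Set M.Num} (hS : S ∈ 𝒵) :
    Df b 𝒵 fun ρ => f ρ ∈ S := by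
  obtain ⟨s, r, hs⟩ := hf
  refine ⟨.mem s 0, fun _ => S, r, fun _ => trivial, fun _ => hS, fun ρ => ?_⟩
  simp only [Sat, hs]

theorem SetDf.of_mem {S : Set M.Num} (hS : S ∈ 𝒵) : SetDf b 𝒵 S := ⟨Df.mem_of_tm inferInstance hS⟩

instance Df.not (P : (ℕ → M.Num) → Prop) [hP : Df b 𝒵 P] : Df b 𝒵 fun ρ => ¬ P ρ := by
  obtain ⟨φ, Z, r, h₁, h₂, h₃⟩ := hP
  exact ⟨.neg φ, Z, r, h₁, h₂, fun ρ => not_congr (h₃ ρ)⟩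

/-- Two definitions can be brought to the same parameters. -/
theorem Df.exists_common {P Q : (ℕ → M.Num) → Prop} (hP : Df b 𝒵 P) (hQ : Df b 𝒵 Q) :
    ∃ (φ ψ : ArithFormula) (Z : ℕ → Set M.Num) (r : ℕ → ℕ ⊕ M.Num),
      (b = true → φ.IsBounded) ∧ (b = true → ψ.IsBounded) ∧ (∀ k, Z k ∈ 𝒵) ∧
      (∀ ρ, P ρ ↔ M.Sat Z (env r ρ) φ) ∧ ∀ ρ, Q ρ ↔ M.Sat Z (env r ρ) ψ := by
  obtain ⟨φ, Z, r, h₁, h₂, h₃⟩ := hP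
  obtain ⟨ψ, Z', r', h₁', h₂', h₃'⟩ := hQ
  refine ⟨φ.ren (fun i => 2 * i) (fun i => 2 * i), ψ.ren (fun i => 2 * i + 1) (fun i => 2 * i + 1),
    merge Z Z', merge r r', fun h => (h₁ h).ren _ _, fun h => (h₁' h).ren _ _, fun k => ?_,
    fun ρ => ?_, fun ρ => ?_⟩
  · unfold merge
    split_ifs
    exacts [h₂ _, h₂' _]
  · rw [sat_ren, env_merge_even, merge_even, h₃]
  · rw [sat_ren, env_merge_odd, merge_odd, h₃']

instance Df.and (P Q : (ℕ → M.Num) → Prop) [hP : Df b 𝒵 P] [hQ : Df b 𝒵 Q] :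
    Df b 𝒵 fun ρ => P ρ ∧ Q ρ := by
  obtain ⟨φ, ψ, Z, r, h₁, h₂, h₃, h₄, h₅⟩ := hP.exists_common hQ
  exact ⟨.and φ ψ, Z, r, fun h => ⟨h₁ h, h₂ h⟩, h₃, fun ρ => and_congr (h₄ ρ) (h₅ ρ)⟩

instance Df.or (P Q : (ℕ → M.Num) → Prop) [hP : Df b 𝒵 P] [hQ : Df b 𝒵 Q] :
    Df b 𝒵 fun ρ => P ρ ∨ Q ρ :=
  Df.of_iff (fun ρ => ¬ (¬ P ρ ∧ ¬ Q ρ)) fun ρ => by tauto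

instance Df.imp (P Q : (ℕ → M.Num) → Prop) [hP : Df b 𝒵 P] [hQ : Df b 𝒵 Q] :
    Df b 𝒵 fun ρ => P ρ → Q ρ :=
  Df.of_iff (fun ρ => ¬ P ρ ∨ Q ρ) fun ρ => by tauto

instance Df.iff (P Q : (ℕ → M.Num) → Prop) [hP : Df b 𝒵 P] [hQ : Df b 𝒵 Q] :
    Df b 𝒵 fun ρ => P ρ ↔ Q ρ :=
  Df.of_iff (fun ρ => (P ρ → Q ρ) ∧ (Q ρ → P ρ)) fun ρ => by tauto

/-- A definition of `Q` in which the distinguished argument is the variable `v₀`. -/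
theorem Df.exists_bind {Q : (ℕ → M.Num) → M.Num → Prop}
    (hQ : Df b 𝒵 fun ρ => Q (fun n => ρ (n + 1)) (ρ 0)) :
    ∃ (φ : ArithFormula) (Z : ℕ → Set M.Num) (r : ℕ → ℕ ⊕ M.Num),
      (b = true → φ.IsBounded) ∧ (∀ k, Z k ∈ 𝒵) ∧
      ∀ ρ a, Q ρ a ↔ M.Sat Z (cons a (env r ρ)) φ := by
  obtain ⟨φ, Z, r, h₁, h₂, h₃⟩ := hQ
  refine ⟨φ.ren id (bindRen r), Z, bindEnv r, fun h => (h₁ h).ren _ _, h₂, fun ρ a => ?_⟩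
  rw [sat_ren, cons_env_comp_bindRen]
  exact h₃ (cons a ρ)

/-- A definition of a binary predicate in which its arguments are the variables `v₀` and `v₁`. -/
theorem Df.exists_bind₂ {Q : M.Num → M.Num → Prop} (hQ : Df b 𝒵 fun ρ => Q (ρ 1) (ρ 0)) :
    ∃ (φ : ArithFormula) (Z : ℕ → Set M.Num) (π : ℕ → M.Num),
      (b = true → φ.IsBounded) ∧ (∀ k, Z k ∈ 𝒵) ∧
      ∀ a c, Q a c ↔ M.Sat Z (cons c (cons a π)) φ := by
  obtain ⟨φ, Z, r, h₁, h₂, h₃⟩ := Df.exists_bind (Q := fun ρ c => Q (ρ 0) c) hQ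
  refine ⟨φ.ren id (liftRen (bindRen r)), Z, env (bindEnv r) (fun _ => M.zero.zero),
    fun h => (h₁ h).ren _ _, h₂, fun a c => ?_⟩
  rw [sat_ren, cons_comp_liftRen, cons_env_comp_bindRen]
  exact h₃ (cons a _) c

theorem Df.ex {Q : (ℕ → M.Num) → M.Num → Prop}
    (hQ : Df false 𝒵 fun ρ => Q (fun n => ρ (n + 1)) (ρ 0)) : Df false 𝒵 fun ρ => ∃ a, Q ρ a := by
  obtain ⟨φ, Z, r, -, h₂, h₃⟩ := Df.exists_bind hQ
  exact ⟨.ex φ, Z, r, by simp, h₂, fun ρ => exists_congr (h₃ ρ)⟩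

theorem Df.bex_of_tm [Nonempty 𝒵] {Q : (ℕ → M.Num) → M.Num → Prop} {t : (ℕ → M.Num) → M.Num}
    (ht : Tm M t) (hQ : Df b 𝒵 fun ρ => Q (fun n => ρ (n + 1)) (ρ 0)) :
    Df b 𝒵 fun ρ => ∃ a, a < t ρ ∧ Q ρ a := by
  obtain ⟨φ, Z, r, h₁, h₂, h₃⟩ := Df.exists_bind hQ
  obtain ⟨t, r', ht⟩ := ht
  refine ⟨.bex (t.ren fun i => 2 * i + 1) (φ.ren id (liftRen fun i => 2 * i)), Z, merge r r',
    fun h => (h₁ h).ren _ _, h₂, fun ρ => exists_congr fun a => ?_⟩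
  rw [sat_ren, cons_comp_liftRen, termVal_ren, env_merge_odd, env_merge_even, ht, h₃]
  rfl

/-- A definable predicate remains definable when its variables are renamed or replaced by
constants. -/
theorem Df.comp_env {P : (ℕ → M.Num) → Prop} (hP : Df b 𝒵 P) (e : ℕ → ℕ ⊕ M.Num) :
    Df b 𝒵 fun ρ => P (env e ρ) := by
  obtain ⟨φ, Z, r, h₁, h₂, h₃⟩ := hP
  refine ⟨φ, Z, fun i => Sum.elim e .inr (r i), h₁, h₂, fun ρ => ?_⟩
  rw [h₃]
  have : env r (env e ρ) = env (fun i => Sum.elim e .inr (r i)) ρ := by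
    funext i
    simp only [env]
    rcases r i <;> rfl
  rw [this]

end Df

/-! ### Arithmetic in a model of `RCA₀` -/

section Arithmetic

variable [hM : Fact M.RCA0]

theorem sigma1_induction {P : M.Num → M.Num → Prop} (hP : Df true M.sets fun ρ => P (ρ 1) (ρ 0))
    (zero : ∃ v, P 0 v) (succ : ∀ n, (∃ v, P n v) → ∃ v, P (n + 1) v) (n : M.Num) :
    ∃ v, P n v := by
  obtain ⟨φ, Z, π, h₁, h₂, h₃⟩ := Df.exists_bind₂ hP
  have key : ∀ n, (∃ v, P n v) ↔ M.Sat Z (cons n π) (.ex φ) := fun n => exists_congr (h₃ n)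
  simp only [key] at zero succ ⊢
  exact hM.out.induction _ ⟨φ, h₁ rfl, rfl⟩ π Z h₂ zero succ n

theorem delta0_induction {P : M.Num → Prop} (hP : Df true M.sets fun ρ => P (ρ 0))
    (zero : P 0) (succ : ∀ n, P n → P (n + 1)) (n : M.Num) : P n := by
  have := sigma1_induction (P := fun n _ => P n) (hP.comp_env fun i => .inl (i + 1))
    ⟨0, zero⟩ (fun n h => ⟨0, succ n h.choose_spec⟩) n
  exact this.choose_spec

theorem num_zero_add (a : M.Num) : 0 + a = a := by
  have hB := hM.out.basic
  refine delta0_induction (P := fun a => 0 + a = a) (Df.eq_of_tm inferInstance inferInstance)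
    (hB.add_zero 0) (fun n h => ?_) a
  rw [hB.add_succ, h]

theorem num_succ_add (a b : M.Num) : a + 1 + b = a + b + 1 := by
  have hB := hM.out.basic
  refine delta0_induction (P := fun b => a + 1 + b = a + b + 1)
    (Df.eq_of_tm inferInstance inferInstance) ?_ (fun n h => ?_) b
  · rw [hB.add_zero, hB.add_zero]
  · rw [hB.add_succ, h, hB.add_succ]

theorem num_add_comm (a b : M.Num) : a + b = b + a := by
  have hB := hM.out.basic
  refine delta0_induction (P := fun b => a + b = b + a)
    (Df.eq_of_tm inferInstance inferInstance) ?_ (fun n h => ?_) b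
  · rw [hB.add_zero, num_zero_add]
  · rw [hB.add_succ, h, num_succ_add]

theorem num_add_assoc (a b c : M.Num) : a + b + c = a + (b + c) := by
  have hB := hM.out.basic
  refine delta0_induction (P := fun c => a + b + c = a + (b + c))
    (Df.eq_of_tm inferInstance inferInstance) ?_ (fun n h => ?_) c
  · rw [hB.add_zero, hB.add_zero]
  · rw [hB.add_succ, h, hB.add_succ, hB.add_succ]

theorem num_left_distrib (a b c : M.Num) : a * (b + c) = a * b + a * c := by
  have hB := hM.out.basic
  refine delta0_induction (P := fun c => a * (b + c) = a * b + a * c)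
    (Df.eq_of_tm inferInstance inferInstance) ?_ (fun n h => ?_) c
  · rw [hB.add_zero, hB.mul_zero, hB.add_zero]
  · rw [hB.add_succ, hB.mul_succ, h, hB.mul_succ, num_add_assoc]

theorem num_zero_mul (a : M.Num) : 0 * a = 0 := by
  have hB := hM.out.basic
  refine delta0_induction (P := fun a => 0 * a = 0) (Df.eq_of_tm inferInstance inferInstance)
    (hB.mul_zero 0) (fun n h => ?_) a
  rw [hB.mul_succ, h, hB.add_zero]

theorem num_succ_mul (a b : M.Num) : (a + 1) * b = a * b + b := by
  have hB := hM.out.basic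
  refine delta0_induction (P := fun b => (a + 1) * b = a * b + b)
    (Df.eq_of_tm inferInstance inferInstance) ?_ (fun n h => ?_) b
  · rw [hB.mul_zero, hB.mul_zero, hB.add_zero]
  · rw [hB.mul_succ, h, hB.mul_succ, hB.add_succ, hB.add_succ, num_add_assoc (a * n) n,
      num_add_comm n, num_add_assoc (a * n) a]

theorem num_mul_comm (a b : M.Num) : a * b = b * a := by
  have hB := hM.out.basic
  refine delta0_induction (P := fun b => a * b = b * a)
    (Df.eq_of_tm inferInstance inferInstance) ?_ (fun n h => ?_) b
  · rw [hB.mul_zero, num_zero_mul]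
  · rw [hB.mul_succ, h, num_succ_mul]

theorem num_mul_assoc (a b c : M.Num) : a * b * c = a * (b * c) := by
  have hB := hM.out.basic
  refine delta0_induction (P := fun c => a * b * c = a * (b * c))
    (Df.eq_of_tm inferInstance inferInstance) ?_ (fun n h => ?_) c
  · rw [hB.mul_zero, hB.mul_zero, hB.mul_zero]
  · rw [hB.mul_succ, h, hB.mul_succ, num_left_distrib]

theorem num_mul_one (a : M.Num) : a * 1 = a := by
  have hB := hM.out.basic
  have := hB.mul_succ a 0
  rwa [num_zero_add, hB.mul_zero, num_zero_add] at this

theorem num_add_right_cancel (a b c : M.Num) (h : a + c = b + c) : a = b := by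
  have hB := hM.out.basic
  refine delta0_induction (P := fun c => a + c = b + c → a = b)
    (@Df.imp _ _ _ _ _ (Df.eq_of_tm inferInstance inferInstance)
      (Df.eq_of_tm inferInstance inferInstance)) ?_ (fun n h => ?_) c h
  · intro h
    rwa [hB.add_zero, hB.add_zero] at h
  · intro h'
    rw [hB.add_succ, hB.add_succ] at h'
    exact h (hB.succ_inj _ _ h')

theorem num_lt_add_succ (a c : M.Num) : a < a + c + 1 := by
  have hB := hM.out.basic
  refine delta0_induction (P := fun c => a < a + c + 1)
    (Df.lt_of_tm inferInstance inferInstance) ?_ (fun n h => ?_) c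
  · rw [hB.add_zero]
    exact (hB.lt_succ _ _).2 (.inr rfl)
  · rw [hB.add_succ]
    exact (hB.lt_succ _ _).2 (.inl h)

theorem num_lt_iff (a b : M.Num) : a < b ↔ ∃ c, b = a + c + 1 := by
  have hB := hM.out.basic
  constructor
  · have := sigma1_induction (P := fun b c => a < b → b = a + c + 1)
      (@Df.imp _ _ _ _ _ (Df.lt_of_tm inferInstance inferInstance)
        (Df.eq_of_tm inferInstance inferInstance)) ⟨0, fun h => (hB.not_lt_zero _ h).elim⟩
      (fun n ⟨c, h⟩ => ?_) b
    · obtain ⟨c, hc⟩ := this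
      exact fun h => ⟨c, hc h⟩
    · by_cases h' : a < n
      · exact ⟨c + 1, fun _ => by rw [h h', hB.add_succ, num_add_assoc, num_add_assoc]⟩
      · refine ⟨0, fun h'' => ?_⟩
        rcases (hB.lt_succ _ _).1 h'' with h₁ | rfl
        · exact (h' h₁).elim
        · rw [hB.add_zero]
  · rintro ⟨c, rfl⟩
    exact num_lt_add_succ a c

theorem num_lt_irrefl (a : M.Num) : ¬ a < a := by
  have hB := hM.out.basic
  intro h
  obtain ⟨c, hc⟩ := (num_lt_iff _ _).1 h
  rw [num_add_assoc] at hc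
  have : 0 + a = c + 1 + a := by rw [num_zero_add, num_add_comm (c + 1) a, ← hc]
  exact hB.succ_ne_zero c (num_add_right_cancel _ _ _ this).symm

theorem num_lt_trans {a b c : M.Num} (h : a < b) (h' : b < c) : a < c := by
  obtain ⟨d, rfl⟩ := (num_lt_iff _ _).1 h
  obtain ⟨e, rfl⟩ := (num_lt_iff _ _).1 h'
  rw [num_add_assoc a d 1, num_add_assoc a]
  exact num_lt_add_succ _ _

theorem num_lt_trichotomy (a b : M.Num) : a < b ∨ a = b ∨ b < a := by
  have hB := hM.out.basic
  refine delta0_induction (P := fun b => a < b ∨ a = b ∨ b < a)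
    (@Df.or _ _ _ _ _ (Df.lt_of_tm inferInstance inferInstance)
      (@Df.or _ _ _ _ _ (Df.eq_of_tm inferInstance inferInstance)
        (Df.lt_of_tm inferInstance inferInstance))) ?_ (fun n h => ?_) b
  · refine delta0_induction (P := fun a => a < 0 ∨ a = 0 ∨ 0 < a)
      (@Df.or _ _ _ _ _ (Df.lt_of_tm inferInstance inferInstance)
        (@Df.or _ _ _ _ _ (Df.eq_of_tm inferInstance inferInstance)
          (Df.lt_of_tm inferInstance inferInstance))) (.inr (.inl rfl)) (fun n h => ?_) a
    refine .inr (.inr ?_)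
    rcases h with h | rfl | h
    · exact (hB.not_lt_zero _ h).elim
    · exact (hB.lt_succ _ _).2 (.inr rfl)
    · exact (hB.lt_succ _ _).2 (.inl h)
  · rcases h with h | rfl | h
    · exact .inl ((hB.lt_succ _ _).2 (.inl h))
    · exact .inl ((hB.lt_succ _ _).2 (.inr rfl))
    · obtain ⟨c, rfl⟩ := (num_lt_iff _ _).1 h
      refine .inr ?_
      by_cases hc : c = 0
      · left
        rw [hc, hB.add_zero]
      · right
        refine (num_lt_iff _ _).2 ?_
        have : 0 < c := by
          refine delta0_induction (P := fun c => c ≠ 0 → 0 < c)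
            (@Df.imp _ _ _ _ _ (@Df.not _ _ _ _ (Df.eq_of_tm inferInstance inferInstance))
              (Df.lt_of_tm inferInstance inferInstance)) (fun h => (h rfl).elim)
            (fun n _ _ => ?_) c hc
          rw [← num_zero_add n]
          exact num_lt_add_succ _ _
        obtain ⟨d, rfl⟩ := (num_lt_iff _ _).1 this
        exact ⟨d, by rw [num_zero_add, ← num_add_assoc, num_succ_add n d]⟩

/-- The numbers of a model of `RCA₀` form a commutative semiring. -/
instance commSemiring : CommSemiring M.Num where
  add_assoc := num_add_assoc
  zero_add := num_zero_add
  add_zero := hM.out.basic.add_zero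
  add_comm := num_add_comm
  left_distrib := num_left_distrib
  right_distrib a b c := by rw [num_mul_comm, num_left_distrib, num_mul_comm c, num_mul_comm c]
  zero_mul := num_zero_mul
  mul_zero := hM.out.basic.mul_zero
  mul_assoc := num_mul_assoc
  one_mul a := by rw [num_mul_comm, num_mul_one]
  mul_one := num_mul_one
  mul_comm := num_mul_comm
  nsmul := nsmulRec

open Classical in
/-- The numbers of a model of `RCA₀` are linearly ordered. -/
noncomputable instance linearOrder : LinearOrder M.Num where
  le a b := a < b ∨ a = b
  le_refl a := .inr rfl
  le_trans a b c h h' := by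
    rcases h with h | rfl
    · rcases h' with h' | rfl
      exacts [.inl (num_lt_trans h h'), .inl h]
    · exact h'
  lt_iff_le_not_ge a b := by
    constructor
    · intro h
      refine ⟨.inl h, ?_⟩
      rintro (h' | rfl)
      exacts [num_lt_irrefl _ (num_lt_trans h h'), num_lt_irrefl _ h]
    · rintro ⟨h | rfl, h'⟩
      exacts [h, (h' (.inr rfl)).elim]
  le_antisymm a b h h' := by
    rcases h with h | rfl
    · rcases h' with h' | rfl
      exacts [(num_lt_irrefl _ (num_lt_trans h h')).elim, rfl]
    · rfl
  le_total a b := by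
    rcases num_lt_trichotomy a b with h | rfl | h
    exacts [.inl (.inl h), .inl (.inr rfl), .inr (.inl h)]
  toDecidableLE := Classical.decRel _

theorem lt_add_one_iff_le (a b : M.Num) : a < b + 1 ↔ a ≤ b := hM.out.basic.lt_succ a b

theorem num_le_iff (a b : M.Num) : a ≤ b ↔ ∃ c, b = a + c := by
  rw [← lt_add_one_iff_le, num_lt_iff]
  exact exists_congr fun c => ⟨num_add_right_cancel _ _ _, fun h => h ▸ rfl⟩

instance isOrderedCancelAddMonoid : IsOrderedCancelAddMonoid M.Num where
  add_le_add_left _ _ h c := by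
    obtain ⟨d, rfl⟩ := (num_le_iff _ _).1 h
    exact (num_le_iff _ _).2 ⟨d, by ring⟩
  le_of_add_le_add_left a b c h := by
    obtain ⟨d, hd⟩ := (num_le_iff _ _).1 h
    refine (num_le_iff _ _).2 ⟨d, num_add_right_cancel _ _ a ?_⟩
    rw [add_comm, hd]; ring

instance canonicallyOrderedAdd : CanonicallyOrderedAdd M.Num where
  exists_add_of_le h := (num_le_iff _ _).1 h
  le_add_self _ b := (num_le_iff _ _).2 ⟨b, add_comm _ _⟩
  le_self_add _ b := (num_le_iff _ _).2 ⟨b, rfl⟩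

instance isStrictOrderedRing : IsStrictOrderedRing M.Num where
  zero_le_one := zero_le
  exists_pair_ne := ⟨0, 1, fun h => num_lt_irrefl (1 : M.Num) (by
    have := (lt_add_one_iff_le (0 : M.Num) 0).2 le_rfl
    rwa [zero_add, h] at this)⟩
  mul_lt_mul_of_pos_left c hc _ _ h := by
    obtain ⟨d, rfl⟩ := (num_lt_iff _ _).1 h
    obtain ⟨e, rfl⟩ := (num_lt_iff _ _).1 hc
    exact (num_lt_iff _ _).2 ⟨d + e * d + e, by ring⟩
  mul_lt_mul_of_pos_right c hc _ _ h := by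
    obtain ⟨d, rfl⟩ := (num_lt_iff _ _).1 h
    obtain ⟨e, rfl⟩ := (num_lt_iff _ _).1 hc
    exact (num_lt_iff _ _).2 ⟨d + e * d + e, by ring⟩

theorem add_one_le_iff_lt {a b : M.Num} : a + 1 ≤ b ↔ a < b := by
  rw [← lt_add_one_iff_le, add_lt_add_iff_right]

theorem num_eq_zero_or_succ (a : M.Num) : a = 0 ∨ ∃ c, a = c + 1 := by
  rcases eq_or_ne a 0 with h | h
  · exact .inl h
  · obtain ⟨c, hc⟩ := (num_lt_iff _ _).1 (pos_iff_ne_zero.2 h)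
    exact .inr ⟨c, by rw [hc, zero_add]⟩

end Arithmetic

/-! ### Term-bounded definable functions -/

section Definability

variable [hM : Fact M.RCA0] {b : Bool} {𝒵 : Set (Set M.Num)}

/-- `f` is bounded by a term and its graph is definable from sets in `𝒵`; such an `f` can be
substituted into definable predicates. -/
class Fn (b : Bool) (𝒵 : Set (Set M.Num)) (f : (ℕ → M.Num) → M.Num) : Prop where
  exists_bound : ∃ t, Tm M t ∧ ∀ ρ, f ρ ≤ t ρ
  df : Df b 𝒵 fun ρ => ρ 0 = f fun n => ρ (n + 1)

/-- The function `f` from numbers to numbers has a definable graph. -/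
class FunDf (b : Bool) (𝒵 : Set (Set M.Num)) (f : M.Num → M.Num) : Prop where
  df : Df b 𝒵 fun ρ => f (ρ 0) = ρ 1

theorem Fn.of_tm [Nonempty 𝒵] {f : (ℕ → M.Num) → M.Num} (hf : Tm M f) : Fn b 𝒵 f :=
  ⟨⟨f, hf, fun _ => le_rfl⟩, Df.eq_of_tm inferInstance hf.shift⟩

instance Fn.var [Nonempty 𝒵] (i : ℕ) : Fn b 𝒵 fun ρ => ρ i := .of_tm inferInstance

instance Fn.const [Nonempty 𝒵] (c : M.Num) : Fn b 𝒵 fun _ => c := .of_tm inferInstance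

theorem Fn.shift {f : (ℕ → M.Num) → M.Num} (hf : Fn b 𝒵 f) :
    Fn b 𝒵 fun ρ => f fun n => ρ (n + 1) := by
  obtain ⟨⟨t, ht, h⟩, h'⟩ := hf
  exact ⟨⟨_, ht.shift, fun ρ => h _⟩, h'.comp_env fun | 0 => .inl 0 | i + 1 => .inl (i + 2)⟩

/-- Substitution of a term-bounded function: `Q ρ (f ρ)` holds iff `Q ρ a` for some `a`, below the
bound of `f`, with `a = f ρ`. -/
theorem Df.subst [Nonempty 𝒵] {Q : (ℕ → M.Num) → M.Num → Prop} (f : (ℕ → M.Num) → M.Num)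
    [hf : Fn b 𝒵 f] (hQ : Df b 𝒵 fun ρ => Q (fun n => ρ (n + 1)) (ρ 0)) :
    Df b 𝒵 fun ρ => Q ρ (f ρ) := by
  obtain ⟨⟨t, ht, h⟩, h'⟩ := hf
  have := Df.bex_of_tm (𝒵 := 𝒵) (b := b) (Q := fun ρ a => a = f ρ ∧ Q ρ a)
    (Tm.add t fun _ => 1) (@Df.and _ _ _ _ _ h' hQ)
  refine Df.of_iff (fun ρ => ∃ a, a < t ρ + 1 ∧ a = f ρ ∧ Q ρ a) fun ρ => ?_
  constructor
  · intro hρ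
    exact ⟨_, (lt_add_one_iff_le _ _).2 (h ρ), rfl, hρ⟩
  · rintro ⟨a, -, rfl, hρ⟩
    exact hρ

variable [Nonempty 𝒵]

theorem Df.comp₅ {P : M.Num → M.Num → M.Num → M.Num → M.Num → Prop}
    (hP : Df b 𝒵 fun ρ => P (ρ 0) (ρ 1) (ρ 2) (ρ 3) (ρ 4)) (f g h k l : (ℕ → M.Num) → M.Num)
    [hf : Fn b 𝒵 f] [hg : Fn b 𝒵 g] [hh : Fn b 𝒵 h] [hk : Fn b 𝒵 k] [hl : Fn b 𝒵 l] :
    Df b 𝒵 fun ρ => P (f ρ) (g ρ) (h ρ) (k ρ) (l ρ) := by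
  have hg := hg.shift
  have hh := hh.shift.shift
  have hk := hk.shift.shift.shift
  have hl := hl.shift.shift.shift.shift
  refine Df.subst (Q := fun ρ a => P a (g ρ) (h ρ) (k ρ) (l ρ)) f ?_
  refine Df.subst (Q := fun ρ a => P (ρ 0) a (h fun n => ρ (n + 1)) (k fun n => ρ (n + 1))
    (l fun n => ρ (n + 1))) (fun ρ => g fun n => ρ (n + 1)) ?_
  refine Df.subst (Q := fun ρ a => P (ρ 1) (ρ 0) a (k fun n => ρ (n + 2))
    (l fun n => ρ (n + 2))) (fun ρ => h fun n => ρ (n + 2)) ?_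
  refine Df.subst (Q := fun ρ a => P (ρ 2) (ρ 1) (ρ 0) a
    (l fun n => ρ (n + 3))) (fun ρ => k fun n => ρ (n + 3)) ?_
  refine Df.subst (Q := fun ρ a => P (ρ 3) (ρ 2) (ρ 1) (ρ 0) a) (fun ρ => l fun n => ρ (n + 4)) ?_
  exact hP.comp_env fun i => .inl (4 - i)

theorem Df.comp₄ {P : M.Num → M.Num → M.Num → M.Num → Prop}
    (hP : Df b 𝒵 fun ρ => P (ρ 0) (ρ 1) (ρ 2) (ρ 3)) (f g h k : (ℕ → M.Num) → M.Num)
    [Fn b 𝒵 f] [Fn b 𝒵 g] [Fn b 𝒵 h] [Fn b 𝒵 k] : Df b 𝒵 fun ρ => P (f ρ) (g ρ) (h ρ) (k ρ) :=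
  Df.comp₅ (P := fun x y z w _ => P x y z w) hP f g h k fun _ => 0

theorem Df.comp₃ {P : M.Num → M.Num → M.Num → Prop} (hP : Df b 𝒵 fun ρ => P (ρ 0) (ρ 1) (ρ 2))
    (f g h : (ℕ → M.Num) → M.Num) [Fn b 𝒵 f] [Fn b 𝒵 g] [Fn b 𝒵 h] :
    Df b 𝒵 fun ρ => P (f ρ) (g ρ) (h ρ) :=
  Df.comp₄ (P := fun x y z _ => P x y z) hP f g h fun _ => 0

theorem Df.comp₂ {P : M.Num → M.Num → Prop} (hP : Df b 𝒵 fun ρ => P (ρ 0) (ρ 1))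
    (f g : (ℕ → M.Num) → M.Num) [Fn b 𝒵 f] [Fn b 𝒵 g] : Df b 𝒵 fun ρ => P (f ρ) (g ρ) :=
  Df.comp₃ (P := fun x y _ => P x y) hP f g fun _ => 0

theorem Df.comp₁ {P : M.Num → Prop} (hP : Df b 𝒵 fun ρ => P (ρ 0))
    (f : (ℕ → M.Num) → M.Num) [Fn b 𝒵 f] : Df b 𝒵 fun ρ => P (f ρ) :=
  Df.comp₂ (P := fun x _ => P x) hP f fun _ => 0

section Instances

variable (f g : (ℕ → M.Num) → M.Num) [hf : Fn b 𝒵 f] [hg : Fn b 𝒵 g]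

instance Df.eq : Df b 𝒵 fun ρ => f ρ = g ρ :=
  Df.comp₂ (Df.eq_of_tm inferInstance inferInstance) f g

instance Df.ne : Df b 𝒵 fun ρ => f ρ ≠ g ρ := Df.not _

instance Df.lt : Df b 𝒵 fun ρ => f ρ < g ρ :=
  Df.comp₂ (Df.lt_of_tm inferInstance inferInstance) f g

instance Df.le : Df b 𝒵 fun ρ => f ρ ≤ g ρ := .of_iff (fun ρ => ¬ g ρ < f ρ) fun _ => not_lt.symm

instance Df.mem (S : Set M.Num) [hS : SetDf b 𝒵 S] : Df b 𝒵 fun ρ => f ρ ∈ S :=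
  Df.comp₁ hS.df f

instance Df.fun_eq (F : M.Num → M.Num) [hF : FunDf b 𝒵 F] : Df b 𝒵 fun ρ => F (f ρ) = g ρ :=
  Df.comp₂ (P := fun x y => F x = y) hF.df f g

instance Df.fun_ne (F : M.Num → M.Num) [hF : FunDf b 𝒵 F] : Df b 𝒵 fun ρ => F (f ρ) ≠ g ρ :=
  Df.not _

omit hg in
instance Df.bex {Q : (ℕ → M.Num) → M.Num → Prop}
    [hQ : Df b 𝒵 fun ρ => Q (fun n => ρ (n + 1)) (ρ 0)] : Df b 𝒵 fun ρ => ∃ a, a < f ρ ∧ Q ρ a := by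
  refine Df.subst (Q := fun ρ c => ∃ a, a < c ∧ Q ρ a) f ?_
  exact Df.bex_of_tm (Q := fun ρ a => Q (fun n => ρ (n + 1)) a) (inferInstance : Tm M fun ρ => ρ 0)
    (hQ.comp_env fun | 0 => .inl 0 | i + 1 => .inl (i + 2))

omit hg in
instance Df.ball {Q : (ℕ → M.Num) → M.Num → Prop}
    [hQ : Df b 𝒵 fun ρ => Q (fun n => ρ (n + 1)) (ρ 0)] : Df b 𝒵 fun ρ => ∀ a, a < f ρ → Q ρ a :=
  .of_iff (fun ρ => ¬ ∃ a, a < f ρ ∧ ¬ Q ρ a) fun ρ => by push Not; rfl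

instance Fn.add : Fn b 𝒵 fun ρ => f ρ + g ρ := by
  obtain ⟨s, hs, h⟩ := hf.exists_bound
  obtain ⟨t, ht, h'⟩ := hg.exists_bound
  have hf := hf.shift
  have hg := hg.shift
  refine ⟨⟨_, Tm.add s t, fun ρ => add_le_add (h ρ) (h' ρ)⟩, ?_⟩
  exact Df.comp₃ (P := fun x y z => x = y + z) (Df.eq_of_tm inferInstance inferInstance)
    (fun ρ => ρ 0) (fun ρ => f fun n => ρ (n + 1)) (fun ρ => g fun n => ρ (n + 1))

instance Fn.mul : Fn b 𝒵 fun ρ => f ρ * g ρ := by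
  obtain ⟨s, hs, h⟩ := hf.exists_bound
  obtain ⟨t, ht, h'⟩ := hg.exists_bound
  have hf := hf.shift
  have hg := hg.shift
  refine ⟨⟨_, Tm.mul s t, fun ρ => mul_le_mul' (h ρ) (h' ρ)⟩, ?_⟩
  exact Df.comp₃ (P := fun x y z => x = y * z) (Df.eq_of_tm inferInstance inferInstance)
    (fun ρ => ρ 0) (fun ρ => f fun n => ρ (n + 1)) (fun ρ => g fun n => ρ (n + 1))

end Instances

instance Df.all {Q : (ℕ → M.Num) → M.Num → Prop}
    [hQ : Df false 𝒵 fun ρ => Q (fun n => ρ (n + 1)) (ρ 0)] : Df false 𝒵 fun ρ => ∀ a, Q ρ a :=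
  have := Df.ex (Q := fun ρ a => ¬ Q ρ a) (@Df.not _ _ _ _ hQ)
  .of_iff (fun ρ => ¬ ∃ a, ¬ Q ρ a) fun ρ => by push Not; rfl

instance Df.exists {Q : (ℕ → M.Num) → M.Num → Prop}
    [hQ : Df false 𝒵 fun ρ => Q (fun n => ρ (n + 1)) (ρ 0)] : Df false 𝒵 fun ρ => ∃ a, Q ρ a :=
  Df.ex hQ

end Definability

section Induction

variable [hM : Fact M.RCA0]

theorem setOf_mem_sets {P : M.Num → Prop} (hP : Df true M.sets fun ρ => P (ρ 0)) :
    {n | P n} ∈ M.sets := by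
  obtain ⟨φ, Z, r, h₁, h₂, h₃⟩ := Df.exists_bind (Q := fun _ a => P a) hP
  have h₄ (n c : M.Num) : P n ↔
      M.Sat Z (cons c (cons n (env r fun _ => 0))) (φ.ren id fun i => i + 1) := by
    rw [sat_ren]
    exact h₃ _ n
  have h₅ := (h₁ rfl).ren id fun i => i + 1
  obtain ⟨X, hX, h⟩ := hM.out.comprehension (.ex (φ.ren id fun i => i + 1))
    (.all (φ.ren id fun i => i + 1)) ⟨_, h₅, rfl⟩ ⟨_, h₅, rfl⟩ (env r fun _ => 0) Z h₂ (fun n =>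
      ⟨fun ⟨c, h⟩ d => (h₄ n d).1 ((h₄ n c).2 h), fun h => ⟨0, h 0⟩⟩)
  convert hX
  ext n
  exact ⟨fun hn => (h n).2 ⟨0, (h₄ n 0).1 hn⟩, fun hn => (h₄ n _).2 ((h n).1 hn).choose_spec⟩

theorem delta0_exists_least {P : M.Num → Prop} (hP : Df true M.sets fun ρ => P (ρ 0))
    (h : ∃ n, P n) : ∃ n, P n ∧ ∀ m, m < n → ¬ P m := by
  by_contra! hne
  obtain ⟨n, hn⟩ := h
  have := hP.comp_env (fun _ => .inl 0)
  have hall : ∀ n, ∀ m, m < n → ¬ P m := by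
    refine delta0_induction (P := fun n => ∀ m, m < n → ¬ P m) inferInstance
      (fun m hm => (hM.out.basic.not_lt_zero m hm).elim) fun n ih m hm hPm => ?_
    rcases (hM.out.basic.lt_succ m n).1 hm with h | rfl
    · exact ih m h hPm
    · obtain ⟨k, hk, hPk⟩ := hne m hPm
      exact ih k hk hPk
  exact hall (n + 1) n ((lt_add_one_iff_le _ _).2 le_rfl) hn

/-- Bounding: below `n`, witnesses for a bounded formula can be found below a common bound. -/
theorem delta0_bounding {P : M.Num → M.Num → Prop} (hP : Df true M.sets fun ρ => P (ρ 0) (ρ 1))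
    (n : M.Num) (h : ∀ i, i < n → ∃ v, P i v) : ∃ c, ∀ i, i < n → ∃ v, v < c ∧ P i v := by
  have hP' : Df true M.sets fun ρ => P (ρ 1) (ρ 0) :=
    hP.comp_env (fun | 0 => .inl 1 | i + 1 => .inl 0)
  have key (j : M.Num) : ∃ c, j ≤ n → ∀ i, i < j → ∃ v, v < c ∧ P i v := by
    refine sigma1_induction (P := fun j c => j ≤ n → ∀ i, i < j → ∃ v, v < c ∧ P i v)
      inferInstance ⟨0, fun _ i hi => (hM.out.basic.not_lt_zero i hi).elim⟩ (fun j ⟨c, hc⟩ => ?_) j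
    by_cases hj : j < n
    · obtain ⟨v, hv⟩ := h j hj
      refine ⟨max c (v + 1), fun _ i hi => ?_⟩
      rcases (hM.out.basic.lt_succ i j).1 hi with h | rfl
      · obtain ⟨w, hw, hw'⟩ := hc hj.le i h
        exact ⟨w, lt_max_of_lt_left hw, hw'⟩
      · exact ⟨v, lt_max_of_lt_right ((lt_add_one_iff_le _ _).2 le_rfl), hv⟩
    · exact ⟨0, fun h => (hj (add_one_le_iff_lt.1 h)).elim⟩
  obtain ⟨c, hc⟩ := key n
  exact ⟨c, hc le_rfl⟩

end Induction

/-! ### The pairing function -/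

section Pairing

variable [hM : Fact M.RCA0]

theorem add_self_lt_add_self {a b : M.Num} : a + a < b + b ↔ a < b := by
  constructor
  · intro h
    by_contra! h'
    exact absurd h (not_lt.2 (add_le_add h' h'))
  · intro h
    exact add_lt_add h h

theorem add_self_inj {a b : M.Num} : a + a = b + b ↔ a = b := by
  refine ⟨fun h => ?_, fun h => h ▸ rfl⟩
  rcases lt_trichotomy a b with h' | h' | h'
  · exact absurd h (add_self_lt_add_self.2 h').ne
  · exact h'
  · exact absurd h (add_self_lt_add_self.2 h').ne'

theorem exists_isPair (i j : M.Num) : ∃ p, IsPair i j p := by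
  obtain ⟨c, hc⟩ := sigma1_induction (P := fun n c => c + c = n * (n + 1)) inferInstance
    ⟨0, by ring⟩ (fun n ⟨c, hc⟩ => ⟨c + n + 1, by linear_combination hc⟩) (i + j)
  exact ⟨c + i, by unfold IsPair; linear_combination hc⟩

/-- The pairing function of `M`. -/
noncomputable def pair (i j : M.Num) : M.Num := (exists_isPair i j).choose

theorem isPair_pair (i j : M.Num) : IsPair i j (pair i j) := (exists_isPair i j).choose_spec

theorem isPair_iff {i j p : M.Num} : IsPair i j p ↔ p = pair i j := by
  refine ⟨fun h => ?_, fun h => h ▸ isPair_pair i j⟩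
  have := isPair_pair i j
  unfold IsPair at this h
  exact add_self_inj.1 (h.trans this.symm)

theorem pair_add_pair (i j : M.Num) : pair i j + pair i j = (i + j) * (i + j + 1) + (i + i) :=
  isPair_pair i j

theorem pair_lt_pair_of_add_lt {i j i' j' : M.Num} (h : i + j < i' + j') :
    pair i j < pair i' j' := by
  rw [← add_self_lt_add_self, pair_add_pair, pair_add_pair]
  obtain ⟨c, hc⟩ := (num_lt_iff _ _).1 h
  rw [hc]
  have : (i + j + c + 1) * (i + j + c + 1 + 1) + (i' + i') =
      ((i + j) * (i + j + 1) + (i + i) + 1) + (2 * j + 1 + (2 * (i + j) * c + c * c + 3 * c)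
        + (i' + i')) := by ring
  rw [this]
  exact lt_of_lt_of_le ((lt_add_one_iff_le _ _).2 le_rfl) le_self_add

theorem pair_inj {i j i' j' : M.Num} : pair i j = pair i' j' ↔ i = i' ∧ j = j' := by
  refine ⟨fun h => ?_, fun ⟨h, h'⟩ => by rw [h, h']⟩
  have hs : i + j = i' + j' := by
    rcases lt_trichotomy (i + j) (i' + j') with h' | h' | h'
    · exact absurd h (pair_lt_pair_of_add_lt h').ne
    · exact h'
    · exact absurd h (pair_lt_pair_of_add_lt h').ne'
  have h₁ := pair_add_pair i j
  rw [h, pair_add_pair, hs] at h₁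
  have := add_self_inj.1 (add_left_cancel h₁)
  subst this
  exact ⟨rfl, add_left_cancel hs⟩

theorem exists_pair_eq (p : M.Num) : ∃ i j, p = pair i j := by
  have key : ∀ p : M.Num, ∃ i, i < p + 1 ∧ ∃ j, j < p + 1 ∧
      p + p = (i + j) * (i + j + 1) + (i + i) := by
    refine delta0_induction (P := fun p => ∃ i, i < p + 1 ∧ ∃ j, j < p + 1 ∧
      p + p = (i + j) * (i + j + 1) + (i + i)) inferInstance ?_ fun p ⟨i, hi, j, hj, h⟩ => ?_
    · exact ⟨0, by simp, 0, by simp, by ring⟩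
    · rcases num_eq_zero_or_succ j with rfl | ⟨j, rfl⟩
      · exact ⟨0, by simp, i + 1, by simpa using hi, by linear_combination h⟩
      · exact ⟨i + 1, by simpa using hi, j, (lt_of_le_of_lt le_self_add hj).trans
          ((lt_add_one_iff_le _ _).2 le_rfl), by linear_combination h⟩
  obtain ⟨i, -, j, -, h⟩ := key p
  exact ⟨i, j, isPair_iff.1 h⟩

/-- The first component of a number, regarded as a pair. -/
noncomputable def left (p : M.Num) : M.Num := (exists_pair_eq p).choose

/-- The second component of a number, regarded as a pair. -/
noncomputable def right (p : M.Num) : M.Num := (exists_pair_eq p).choose_spec.choose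

@[simp] theorem pair_left_right (p : M.Num) : pair (left p) (right p) = p :=
  (exists_pair_eq p).choose_spec.choose_spec.symm

@[simp] theorem left_pair (i j : M.Num) : left (pair i j) = i :=
  (pair_inj.1 (pair_left_right (pair i j))).1

@[simp] theorem right_pair (i j : M.Num) : right (pair i j) = j :=
  (pair_inj.1 (pair_left_right (pair i j))).2

theorem eq_pair_iff {p i j : M.Num} : p = pair i j ↔ left p = i ∧ right p = j := by
  conv_lhs => rw [← pair_left_right p, pair_inj]

theorem le_mul_self_num (a : M.Num) : a ≤ a * a := by
  rcases num_eq_zero_or_succ a with rfl | ⟨c, rfl⟩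
  · exact zero_le
  · exact (num_le_iff _ _).2 ⟨c * c + c, by ring⟩

theorem add_le_pair (i j : M.Num) : i + j ≤ pair i j := by
  by_contra! h
  have h' := add_self_lt_add_self.2 h
  rw [pair_add_pair] at h'
  have h₁ : (i + j) + (i + j) ≤ (i + j) * (i + j + 1) + (i + i) := by
    calc (i + j) + (i + j) ≤ (i + j) * (i + j) + (i + j) :=
          add_le_add_left (le_mul_self_num _) _
      _ ≤ (i + j) * (i + j + 1) + (i + i) := (num_le_iff _ _).2 ⟨i + i, by ring⟩
  exact absurd h' (not_lt.2 h₁)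

theorem left_le_pair (i j : M.Num) : i ≤ pair i j := le_self_add.trans (add_le_pair i j)

theorem right_le_pair (i j : M.Num) : j ≤ pair i j := le_add_self.trans (add_le_pair i j)

theorem left_le (p : M.Num) : left p ≤ p := by
  conv_rhs => rw [← pair_left_right p]
  exact left_le_pair _ _

theorem right_le (p : M.Num) : right p ≤ p := by
  conv_rhs => rw [← pair_left_right p]
  exact right_le_pair _ _

theorem pair_lt_pair_right (i : M.Num) {j j' : M.Num} (h : j < j') : pair i j < pair i j' :=
  pair_lt_pair_of_add_lt (add_lt_add_right h i)

theorem pair_le_pair_right (i : M.Num) {j j' : M.Num} (h : j ≤ j') : pair i j ≤ pair i j' := by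
  rcases h.lt_or_eq with h | rfl
  exacts [(pair_lt_pair_right i h).le, le_rfl]

theorem pairMem_iff {X : Set M.Num} {i j : M.Num} : PairMem X i j ↔ pair i j ∈ X := by
  simp only [PairMem, isPair_iff, exists_eq_left]

section

variable {b : Bool} {𝒵 : Set (Set M.Num)} [Nonempty 𝒵] (f g : (ℕ → M.Num) → M.Num)
  [hf : Fn b 𝒵 f] [hg : Fn b 𝒵 g]

instance Fn.pair : Fn b 𝒵 fun ρ => pair (f ρ) (g ρ) := by
  obtain ⟨s, hs, h⟩ := hf.exists_bound
  obtain ⟨t, ht, h'⟩ := hg.exists_bound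
  have hf := hf.shift
  have hg := hg.shift
  refine ⟨⟨_, Tm.add (fun ρ => (s ρ + t ρ) * (s ρ + t ρ + 1)) (fun ρ => s ρ + s ρ)
    (hf := Tm.mul _ _ (hf := Tm.add _ _) (hg := Tm.add _ _ (hf := Tm.add _ _)))
    (hg := Tm.add _ _), fun ρ => ?_⟩, ?_⟩
  · refine (le_self_add (b := L2Structure.pair (f ρ) (g ρ))).trans ?_
    rw [pair_add_pair]
    have h := h ρ
    have h' := h' ρ
    exact add_le_add (mul_le_mul' (add_le_add h h') (add_le_add (add_le_add h h') le_rfl))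
      (add_le_add h h)
  · refine Df.comp₃ (P := fun x y z => x = L2Structure.pair y z) ?_ (fun ρ => ρ 0)
      (fun ρ => f fun n => ρ (n + 1)) (fun ρ => g fun n => ρ (n + 1))
    exact Df.of_iff (fun ρ => ρ 0 + ρ 0 = (ρ 1 + ρ 2) * (ρ 1 + ρ 2 + 1) + (ρ 1 + ρ 1))
      fun ρ => isPair_iff.symm

instance Fn.left : Fn b 𝒵 fun ρ => left (f ρ) := by
  obtain ⟨s, hs, h⟩ := hf.exists_bound
  have hf := hf.shift
  refine ⟨⟨s, hs, fun ρ => (left_le _).trans (h ρ)⟩, ?_⟩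
  refine Df.comp₂ (P := fun x y => x = L2Structure.left y) ?_ (fun ρ => ρ 0)
    (fun ρ => f fun n => ρ (n + 1))
  refine Df.of_iff (fun ρ => ∃ j, j < ρ 1 + 1 ∧ ρ 1 = L2Structure.pair (ρ 0) j) fun ρ => ?_
  constructor
  · intro h
    exact ⟨right (ρ 1), (lt_add_one_iff_le _ _).2 (right_le _), by rw [h, pair_left_right]⟩
  · rintro ⟨j, -, h⟩
    rw [h, left_pair]

instance Fn.right : Fn b 𝒵 fun ρ => right (f ρ) := by
  obtain ⟨s, hs, h⟩ := hf.exists_bound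
  have hf := hf.shift
  refine ⟨⟨s, hs, fun ρ => (right_le _).trans (h ρ)⟩, ?_⟩
  refine Df.comp₂ (P := fun x y => x = L2Structure.right y) ?_ (fun ρ => ρ 0)
    (fun ρ => f fun n => ρ (n + 1))
  refine Df.of_iff (fun ρ => ∃ j, j < ρ 1 + 1 ∧ ρ 1 = L2Structure.pair j (ρ 0)) fun ρ => ?_
  constructor
  · intro h
    exact ⟨L2Structure.left (ρ 1), (lt_add_one_iff_le _ _).2 (left_le _), by
      rw [h, pair_left_right]⟩
  · rintro ⟨j, -, h⟩
    rw [h, right_pair]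

end

end Pairing

/-! ### Codes of finite sequences -/

section Beta

variable [hM : Fact M.RCA0]

/-- The set of `M` that codes the function `f`. -/
def graph (f : M.Num → M.Num) : Set M.Num := {p | f (left p) = right p}

theorem pairMem_graph {f : M.Num → M.Num} {i v : M.Num} : PairMem (graph f) i v ↔ f i = v := by
  simp [pairMem_iff, graph]

theorem FunDf.of_graph {b : Bool} {𝒵 : Set (Set M.Num)} [Nonempty 𝒵] {f : M.Num → M.Num}
    (_h : SetDf b 𝒵 (graph f)) : FunDf b 𝒵 f :=
  ⟨.of_iff (fun ρ => pair (ρ 0) (ρ 1) ∈ graph f) fun ρ => by simp [graph]⟩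

theorem FunDf.of_graph_mem {f : M.Num → M.Num} (h : graph f ∈ M.sets) : FunDf true M.sets f :=
  .of_graph (.of_mem h)

theorem graph_mem_sets (f : M.Num → M.Num) [FunDf true M.sets f] : graph f ∈ M.sets :=
  setOf_mem_sets (P := fun p => f (left p) = right p) inferInstance

theorem isFun_graph {f : M.Num → M.Num} (h : graph f ∈ M.sets) : IsFun (graph f) :=
  ⟨h, fun i => ⟨f i, pairMem_graph.2 rfl, fun _ hv => (pairMem_graph.1 hv).symm⟩⟩

theorem IsFun.exists_graph {F : Set M.Num} (h : IsFun F) : ∃ f, F = graph f := by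
  choose f hf hf' using h.2
  refine ⟨f, ?_⟩
  ext p
  rw [← pair_left_right p, ← pairMem_iff, ← pairMem_iff, pairMem_graph]
  exact ⟨fun hp => (hf' _ _ hp).symm, fun hp => hp ▸ hf _⟩

theorem len_iff {s l : M.Num} : Len s l ↔ left s = l := by
  simp only [Len, isPair_iff]
  constructor
  · rintro ⟨c, rfl⟩
    exact left_pair _ _
  · rintro rfl
    exact ⟨_, (pair_left_right s).symm⟩

theorem entry_iff {s i v : M.Num} : Entry s i v ↔ i < left s ∧
    v < (i + 1) * left (right s) + 1 ∧
      ∃ q, right (right s) = q * ((i + 1) * left (right s) + 1) + v := by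
  simp only [Entry, isPair_iff]
  constructor
  · rintro ⟨l, m, n, c, rfl, rfl, h⟩
    simpa using h
  · intro h
    exact ⟨_, _, _, _, rfl, by simp, h⟩

theorem le_mul_of_pos (a : M.Num) {d : M.Num} (hd : 0 < d) : a ≤ a * d :=
  le_mul_of_one_le_right zero_le (by rw [← zero_add (1 : M.Num)]; exact add_one_le_iff_lt.2 hd)

theorem eq_of_mul_add_eq {d q q' v v' : M.Num} (hv : v < d) (hv' : v' < d)
    (h : q * d + v = q' * d + v') : v = v' := by
  have key {q q' v v' : M.Num} (hv : v < d) (h : q * d + v = q' * d + v') : ¬ q < q' := by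
    intro hq
    obtain ⟨c, rfl⟩ := (num_lt_iff _ _).1 hq
    have h₁ : q * d + v = q * d + (d + (c * d + v')) := by linear_combination h
    have h₂ := add_left_cancel h₁
    exact absurd hv (not_lt.2 (h₂ ▸ le_self_add))
  have hqq : q = q' := le_antisymm (not_lt.1 (key hv' h.symm)) (not_lt.1 (key hv h))
  subst hqq
  exact add_left_cancel h

theorem exists_eq_mul_add (n : M.Num) {d : M.Num} (hd : 0 < d) :
    ∃ q v, v < d ∧ n = q * d + v := by
  have key : ∀ n : M.Num, ∃ q, q < n + 1 ∧ ∃ v, v < d ∧ n = q * d + v := by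
    refine delta0_induction (P := fun n => ∃ q, q < n + 1 ∧ ∃ v, v < d ∧ n = q * d + v)
      inferInstance ⟨0, by simp, 0, hd, by simp⟩ fun n ⟨q, hq, v, hv, h⟩ => ?_
    rcases (add_one_le_iff_lt.2 hv).lt_or_eq with h' | h'
    · exact ⟨q, hq.trans ((lt_add_one_iff_le _ _).2 le_rfl), v + 1, h', by rw [h]; ring⟩
    · exact ⟨q + 1, by simpa using hq, 0, hd, by rw [h, ← h']; ring⟩
  obtain ⟨q, -, v, h⟩ := key n
  exact ⟨q, v, h⟩

theorem Entry.lt {s i v : M.Num} (h : Entry s i v) : i < left s := (entry_iff.1 h).1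

theorem Entry.unique {s i v w : M.Num} (h : Entry s i v) (h' : Entry s i w) : v = w := by
  obtain ⟨-, hv, q, hq⟩ := entry_iff.1 h
  obtain ⟨-, hw, q', hq'⟩ := entry_iff.1 h'
  exact eq_of_mul_add_eq hv hw (hq.symm.trans hq')

theorem Entry.exists {s i : M.Num} (h : i < left s) : ∃ v, Entry s i v := by
  obtain ⟨q, v, hv, h'⟩ := exists_eq_mul_add (right (right s))
    (d := (i + 1) * left (right s) + 1) (lt_of_le_of_lt zero_le ((lt_add_one_iff_le _ _).2 le_rfl))
  exact ⟨v, entry_iff.2 ⟨h, hv, q, h'⟩⟩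

theorem Entry.le {s i v : M.Num} (h : Entry s i v) : v ≤ s := by
  obtain ⟨-, -, q, hq⟩ := entry_iff.1 h
  exact (le_add_self.trans hq.ge).trans ((right_le _).trans (right_le _))

section

variable {b : Bool} {𝒵 : Set (Set M.Num)} [Nonempty 𝒵] (f g h : (ℕ → M.Num) → M.Num)
  [hf : Fn b 𝒵 f] [hg : Fn b 𝒵 g] [hh : Fn b 𝒵 h]

instance Df.entry : Df b 𝒵 fun ρ => Entry (f ρ) (g ρ) (h ρ) := by
  refine Df.comp₃ (P := Entry) ?_ f g h
  refine .of_iff (fun ρ => ρ 1 < left (ρ 0) ∧ ρ 2 < (ρ 1 + 1) * left (right (ρ 0)) + 1 ∧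
      ∃ q, q < right (right (ρ 0)) + 1 ∧
        right (right (ρ 0)) = q * ((ρ 1 + 1) * left (right (ρ 0)) + 1) + ρ 2) fun ρ => ?_
  rw [entry_iff]
  refine and_congr_right fun _ => and_congr_right fun _ => exists_congr fun q =>
    ⟨fun h => ⟨(lt_add_one_iff_le _ _).2 ?_, h⟩, fun h => h.2⟩
  exact (le_mul_of_pos q (lt_of_le_of_lt zero_le ((lt_add_one_iff_le _ _).2 le_rfl))).trans
    (le_self_add.trans h.ge)

theorem sameSeq_iff {s t : M.Num} : SameSeq s t ↔ left s = left t ∧ ∀ i, i < left s →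
    ∀ v, v < s + 1 → Entry s i v → Entry t i v := by
  simp only [SameSeq, len_iff]
  constructor
  · rintro ⟨h, h'⟩
    exact ⟨(h _).2 rfl, fun i _ v _ => (h' i v).1⟩
  · rintro ⟨h, h'⟩
    refine ⟨fun l => by rw [h], fun i v => ⟨fun hv => h' i hv.lt v
      ((lt_add_one_iff_le _ _).2 hv.le) hv, fun hv => ?_⟩⟩
    obtain ⟨w, hw⟩ := Entry.exists (h.symm ▸ hv.lt)
    have := h' i hw.lt w ((lt_add_one_iff_le _ _).2 hw.le) hw
    rwa [hv.unique this]

instance Df.sameSeq : Df b 𝒵 fun ρ => SameSeq (f ρ) (g ρ) :=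
  Df.comp₂ (P := SameSeq) (.of_iff (fun ρ => left (ρ 0) = left (ρ 1) ∧ ∀ i, i < left (ρ 0) →
    ∀ v, v < ρ 0 + 1 → Entry (ρ 0) i v → Entry (ρ 1) i v) fun _ => sameSeq_iff) f g

instance Df.isSeq : Df b 𝒵 fun ρ => IsSeq (f ρ) :=
  Df.comp₁ (P := IsSeq) (.of_iff (fun ρ => ∀ t, t < ρ 0 → ¬ SameSeq (ρ 0) t) fun _ =>
    forall_congr' fun _ => by tauto) f

end

omit hM in
theorem SameSeq.trans {s t u : M.Num} (h : SameSeq s t) (h' : SameSeq t u) : SameSeq s u :=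
  ⟨fun l => (h.1 l).trans (h'.1 l), fun i v => (h.2 i v).trans (h'.2 i v)⟩

/-- Every sequence has a least code. -/
theorem exists_isSeq_sameSeq (s : M.Num) : ∃ t, IsSeq t ∧ SameSeq s t := by
  obtain ⟨t, ht, hmin⟩ := delta0_exists_least (P := fun t => SameSeq s t) inferInstance
    ⟨s, fun _ => Iff.rfl, fun _ _ => Iff.rfl⟩
  exact ⟨t, fun u hu hut => hmin u hut (ht.trans hu), ht⟩

theorem exists_common_multiple (n : M.Num) : ∃ m : M.Num, 0 < m ∧ ∀ e, e < n → e + 1 ∣ m := by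
  have key : ∀ n : M.Num, ∃ m, 0 < m ∧ ∀ e, e < n → ∃ c, c < m + 1 ∧ m = (e + 1) * c := by
    refine sigma1_induction
      (P := fun n m => 0 < m ∧ ∀ e, e < n → ∃ c, c < m + 1 ∧ m = (e + 1) * c)
      inferInstance ⟨1, by simp⟩ fun n ⟨m, hm, h⟩ => ⟨m * (n + 1), ?_, fun e he => ?_⟩
    · exact mul_pos hm (by positivity)
    · rcases ((lt_add_one_iff_le _ _).1 he).lt_or_eq with h' | rfl
      · obtain ⟨c, hc, hc'⟩ := h e h'
        refine ⟨c * (n + 1), (lt_add_one_iff_le _ _).2 ?_, by rw [hc']; ring⟩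
        exact mul_le_mul' ((lt_add_one_iff_le _ _).1 hc) le_rfl
      · exact ⟨m, (lt_add_one_iff_le _ _).2 (le_mul_of_pos _ (by positivity)), mul_comm _ _⟩
  obtain ⟨m, hm, h⟩ := key n
  exact ⟨m, hm, fun e he => let ⟨c, _, hc⟩ := h e he; ⟨c, hc⟩⟩

/-- The moduli `(i + 1) m + 1` and `(i + e + 1) m + 1` are coprime if `e` divides `m`: the first has
an inverse modulo the second. -/
theorem exists_inverse_modulus {i e m : M.Num} (hm : 0 < m) (h : e ∣ m) :
    ∃ x y, ((i + 1) * m + 1) * x = ((i + e + 1) * m + 1) * y + 1 := by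
  obtain ⟨c, hc⟩ := h
  obtain ⟨w, hw⟩ := (num_lt_iff _ _).1 (mul_pos (a := i + e + 1) (by positivity) hm)
  rw [zero_add] at hw
  -- Modulo `d = (i + e + 1) m + 1` the first modulus is `-e m`, and `e c = m`; therefore it is
  -- inverted by `m c (i + e + 1) ^ 3`, as `((i + e + 1) m) ^ 3` is `-1` modulo `d`.
  refine ⟨m * c * (i + e + 1) ^ 3, m * c * (i + e + 1) ^ 2 * (i + 1) + w, ?_⟩
  have h₁ : ((i + 1) * m + 1) * (m * c * (i + e + 1) ^ 3) + (i + e + 1) ^ 2 * m * (e * c) =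
      ((i + e + 1) * m + 1) * (m * c * (i + e + 1) ^ 2 * (i + 1)) +
        (i + e + 1) ^ 2 * m * (e * c) + (i + e + 1) ^ 2 * m * (e * c) := by
    ring
  have h₂ := add_right_cancel h₁
  rw [h₂, ← hc]
  have h₃ : (i + e + 1) ^ 2 * m * m = (w + 1) * (w + 1) := by rw [← hw]; ring
  rw [h₃, hw]
  ring

set_option synthInstance.maxSize 1000 in
set_option synthInstance.maxHeartbeats 200000 in
/-- Initial segments of definable functions have codes. The code is found by the Chinese remainder
theorem, solving the congruences one after the other. -/
theorem exists_code (f : M.Num → M.Num) [FunDf true M.sets f] (n : M.Num) :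
    ∃ s, IsSeq s ∧ left s = n ∧ ∀ i v, Entry s i v ↔ i < n ∧ f i = v := by
  obtain ⟨c, hc⟩ := delta0_bounding (P := fun i v => f i = v) inferInstance n fun i _ => ⟨_, rfl⟩
  obtain ⟨m, hm, hdvd⟩ := exists_common_multiple (n + c)
  -- The values below `n` are smaller than all moduli.
  have hfm {i : M.Num} (hi : i < n) : f i < (i + 1) * m + 1 := by
    obtain ⟨v, hv, hfi⟩ := hc i hi
    rw [lt_add_one_iff_le, hfi]
    have h₁ : v < n + c := hv.trans_le le_add_self
    obtain ⟨e, he⟩ := hdvd v h₁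
    have he0 : 0 < e := by
      rcases eq_or_ne e 0 with rfl | h
      · rw [mul_zero] at he
        exact absurd he hm.ne'
      · exact pos_iff_ne_zero.2 h
    have h₂ : v ≤ m := he ▸ le_self_add.trans (le_mul_of_pos (v + 1) he0)
    calc v ≤ m := h₂
      _ ≤ m * (i + 1) := le_mul_of_pos m (by positivity)
      _ = (i + 1) * m := mul_comm _ _
  -- `N` has the correct remainders for the first `j` moduli, and `Q` is a common multiple of these
  -- moduli that is invertible modulo each of the remaining ones. The bound `w` makes this `Σ⁰₁`.
  have key : ∀ j, ∃ w, j ≤ n → ∃ N, N < w ∧ ∃ Q, Q < w ∧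
      (∀ i, i < j → (∃ e, e < Q + 1 ∧ Q = e * ((i + 1) * m + 1)) ∧
        ∃ v, v < c ∧ f i = v ∧ ∃ q, q < N + 1 ∧ N = q * ((i + 1) * m + 1) + v) ∧
      ∀ k, k < n → j ≤ k → ∃ x, x < w ∧ ∃ y, y < w ∧ Q * x = ((k + 1) * m + 1) * y + 1 := by
    have hpos (i : M.Num) : 0 < (i + 1) * m + 1 := by positivity
    refine sigma1_induction (P := fun j w => j ≤ n → ∃ N, N < w ∧ ∃ Q, Q < w ∧
      (∀ i, i < j → (∃ e, e < Q + 1 ∧ Q = e * ((i + 1) * m + 1)) ∧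
        ∃ v, v < c ∧ f i = v ∧ ∃ q, q < N + 1 ∧ N = q * ((i + 1) * m + 1) + v) ∧
      ∀ k, k < n → j ≤ k → ∃ x, x < w ∧ ∃ y, y < w ∧ Q * x = ((k + 1) * m + 1) * y + 1)
      inferInstance ?_ fun j ⟨w, hw⟩ => ?_
    · have h1 : (1 : M.Num) < 1 + 1 := (lt_add_one_iff_le _ _).2 le_rfl
      refine ⟨1 + 1, fun _ => ⟨0, by positivity, 1, h1, fun i hi => (not_lt.2 zero_le hi).elim,
        fun k _ _ => ⟨1, h1, 0, by positivity, by ring⟩⟩⟩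
    · by_cases hj : j < n
      swap
      · exact ⟨0, fun h => (hj (add_one_le_iff_lt.1 h)).elim⟩
      obtain ⟨N, -, Q, -, hQ, hcop⟩ := hw hj.le
      obtain ⟨x, -, y, -, hxy⟩ := hcop j hj le_rfl
      obtain ⟨v, hv, hfj⟩ := hc j hj
      -- Modulo the next modulus, `Q x` is `1` and `(j + 1) m` is `-1`, so that `N'` is `v`.
      set N' := N + Q * x * (v + (j + 1) * m * N) with hN'
      set Q' := Q * ((j + 1) * m + 1) with hQ'
      obtain ⟨c', hc'⟩ := delta0_bounding (P := fun k w => j + 1 ≤ k → ∃ x, x < w ∧ ∃ y, y < w ∧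
        Q' * x = ((k + 1) * m + 1) * y + 1) inferInstance n (by
          intro k hk
          by_cases hjk : j + 1 ≤ k
          · obtain ⟨x₁, -, y₁, -, h₁⟩ := hcop k hk (le_self_add.trans hjk)
            obtain ⟨e, rfl⟩ := (num_le_iff _ _).1 hjk
            have hk' : j + 1 + e = j + (e + 1) := by ring
            rw [hk'] at hk h₁ ⊢
            have he : e < n + c :=
              ((lt_add_one_iff_le _ _).2 le_rfl).trans_le
                (le_add_self.trans (hk.le.trans le_self_add))
            obtain ⟨x₂, y₂, h₂⟩ := exists_inverse_modulus (i := j) hm (hdvd e he)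
            refine ⟨x₁ * x₂ + (((j + (e + 1) + 1) * m + 1) * y₁ * y₂ + y₁ + y₂) + 1,
              fun _ => ⟨x₁ * x₂, (lt_add_one_iff_le _ _).2 le_self_add, _,
                (lt_add_one_iff_le _ _).2 le_add_self, ?_⟩⟩
            calc Q' * (x₁ * x₂) = (Q * x₁) * (((j + 1) * m + 1) * x₂) := by rw [hQ']; ring
              _ = _ := by rw [h₁, h₂]; ring
          · exact ⟨0, fun h => (hjk h).elim⟩)
      refine ⟨N' + Q' + c' + 1, fun _ => ⟨N', (lt_add_one_iff_le _ _).2 ?_, Q',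
        (lt_add_one_iff_le _ _).2 ?_, fun i hi => ?_, fun k hk hjk => ?_⟩⟩
      · rw [add_assoc]; exact le_self_add
      · rw [add_right_comm]; exact le_add_self
      · rcases ((lt_add_one_iff_le _ _).1 hi).lt_or_eq with hij | rfl
        · obtain ⟨⟨e, -, he⟩, v', hv', hfi, q, -, hq⟩ := hQ i hij
          have h₁ : Q' = e * ((j + 1) * m + 1) * ((i + 1) * m + 1) := by rw [hQ', he]; ring
          have h₂ : N' = (q + e * x * (v + (j + 1) * m * N)) * ((i + 1) * m + 1) + v' := by
            rw [hN', he]; nth_rw 1 [hq]; ring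
          refine ⟨⟨_, (lt_add_one_iff_le _ _).2 ?_, h₁⟩, v', hv', hfi, _,
            (lt_add_one_iff_le _ _).2 ?_, h₂⟩
          · exact (le_mul_of_pos _ (hpos i)).trans h₁.ge
          · exact (le_mul_of_pos _ (hpos i)).trans (le_self_add.trans h₂.ge)
        · have h₂ : N' = (N + y * (v + (i + 1) * m * N)) * ((i + 1) * m + 1) + v := by
            rw [hN', hxy]; ring
          refine ⟨⟨Q, (lt_add_one_iff_le _ _).2 (le_mul_of_pos _ (hpos i)), hQ'⟩, v, hv, hfj, _,
            (lt_add_one_iff_le _ _).2 ?_, h₂⟩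
          exact (le_mul_of_pos _ (hpos i)).trans (le_self_add.trans h₂.ge)
      · obtain ⟨w', hw', h⟩ := hc' k hk
        obtain ⟨x', hx', y', hy', h'⟩ := h hjk
        have hle : w' < N' + Q' + c' + 1 := (lt_add_one_iff_le _ _).2 (hw'.le.trans le_add_self)
        exact ⟨x', hx'.trans hle, y', hy'.trans hle, h'⟩
  obtain ⟨w, hw⟩ := key n
  obtain ⟨N, -, Q, -, hN, -⟩ := hw le_rfl
  obtain ⟨s, hs, hsame⟩ := exists_isSeq_sameSeq (pair n (pair m N))
  refine ⟨s, hs, len_iff.1 ((hsame.1 n).1 (len_iff.2 (left_pair _ _))), fun i v => ?_⟩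
  rw [← hsame.2, entry_iff]
  simp only [left_pair, right_pair]
  refine and_congr_right fun hi => ?_
  obtain ⟨-, v', -, hfi, q, -, hq⟩ := hN i hi
  have hlt := hfm hi
  rw [hfi] at hlt ⊢
  constructor
  · rintro ⟨hv, q', hq'⟩
    exact eq_of_mul_add_eq hlt hv (hq.symm.trans hq')
  · rintro rfl
    exact ⟨hlt, q, hq⟩

end Beta

/-! ### `Π⁰₁` classes as sets of paths -/

section Trees

variable [hM : Fact M.RCA0]

/-- The graph of the finite sequence coded by `s`. -/
def seqGraph (s : M.Num) : Set M.Num := {p | Entry s (left p) (right p)}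

/-- Every `Π⁰₁` class of functions is the set of paths of a tree; `Ψ z X` is the part of the
definition that concerns the values of `X` at arguments below `z`. -/
theorem exists_tree {Ψ : M.Num → Set M.Num → Prop}
    (hΨ : Df true M.sets fun ρ => Ψ (ρ 0) (seqGraph (ρ 1)))
    (huse : ∀ z X X', (∀ p, left p < z → (p ∈ X ↔ p ∈ X')) → Ψ z X → Ψ z X') :
    ∃ T : Set M.Num, IsTree T ∧
      ∀ f, graph f ∈ M.sets → (IsPath T (graph f) ↔ ∀ z, Ψ z (graph f)) := by
  have hΨ' : Df true M.sets fun ρ => ∀ z, z < left (ρ 0) + 1 → Ψ z (seqGraph (ρ 0)) := by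
    have : Df true M.sets fun ρ => Ψ (ρ 0) (seqGraph (ρ (0 + 1))) := hΨ
    infer_instance
  refine ⟨{s | IsSeq s ∧ ∀ z, z < left s + 1 → Ψ z (seqGraph s)}, ⟨?_, fun s hs => hs.1, ?_⟩, ?_⟩
  · exact setOf_mem_sets (P := fun s => IsSeq s ∧ ∀ z, z < left s + 1 → Ψ z (seqGraph s))
      inferInstance
  · rintro s ⟨-, hs⟩ t ht hpre
    have hlen : left t ≤ left s := by
      by_contra! h
      obtain ⟨v, hv⟩ := Entry.exists h
      exact absurd (hpre _ _ hv).lt (lt_irrefl _)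
    refine ⟨ht, fun z hz => ?_⟩
    have hz' := (lt_add_one_iff_le _ _).1 hz
    refine huse z _ _ (fun p hp => ?_) (hs z ((lt_add_one_iff_le _ _).2 (hz'.trans hlen)))
    refine ⟨fun h => ?_, fun h => hpre _ _ h⟩
    obtain ⟨v, hv⟩ := Entry.exists (hp.trans_le hz')
    have : right p = v := Entry.unique h (hpre _ _ hv)
    change Entry t _ _
    rwa [this]
  · intro f hf
    have := FunDf.of_graph_mem hf
    constructor
    · rintro ⟨-, h⟩ z
      obtain ⟨s, ⟨-, hs⟩, -, hlen, hres⟩ := h z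
      rw [len_iff] at hlen
      refine huse z _ _ (fun p hp => ?_)
        (hs z (by rw [hlen]; exact (lt_add_one_iff_le _ _).2 le_rfl))
      constructor
      · intro h
        exact pairMem_graph.1 (hres _ _ h)
      · intro h
        obtain ⟨v, hv⟩ := Entry.exists (hlen ▸ hp)
        have h' := pairMem_graph.1 (hres _ _ hv)
        have : right p = v := (Eq.symm h).trans h'
        change Entry s _ _
        rwa [this]
    · intro h
      refine ⟨isFun_graph hf, fun n => ?_⟩
      obtain ⟨s, hs, hlen, hent⟩ := exists_code f n
      refine ⟨s, ⟨hs, fun z hz => ?_⟩, hs, len_iff.2 hlen,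
        fun i v hv => pairMem_graph.2 ((hent i v).1 hv).2⟩
      refine huse z _ _ (fun p hp => ?_) (h z)
      refine Iff.trans ?_ (hent _ _).symm
      rw [hlen] at hz
      exact ⟨fun h => ⟨hp.trans_le ((lt_add_one_iff_le _ _).1 hz), h⟩, fun h => h.2⟩

theorem add_self_ne_add_self_add_one (a c : M.Num) : a + a ≠ c + c + 1 := by
  intro h
  rcases le_or_gt a c with h' | h'
  · exact absurd ((lt_add_one_iff_le _ _).2 (add_le_add h' h')) (by rw [h]; exact lt_irrefl _)
  · obtain ⟨d, rfl⟩ := (num_lt_iff _ _).1 h'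
    have : c + c + 1 + 0 = c + c + 1 + (d + d + 1) := by linear_combination h.symm
    have := add_left_cancel this
    exact absurd this (by positivity : (0 : M.Num) < d + d + 1).ne

theorem setDf_join_right {b : Bool} (T F : Set M.Num) : SetDf b {join T F} F := by
  have : SetDf b {join T F} (join T F) := .of_mem rfl
  refine ⟨.of_iff (fun ρ => ρ 0 + ρ 0 + 1 ∈ join T F) fun ρ => ⟨fun h => .inr ⟨_, h, rfl⟩, ?_⟩⟩
  rintro (⟨n, -, h⟩ | ⟨n, hn, h⟩)
  · exact (add_self_ne_add_self_add_one _ _ h.symm).elim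
  · rwa [add_self_inj.1 (add_right_cancel h)]

omit hM in
theorem computableIn_of_setDf {W X : Set M.Num} (h : SetDf true {X} W) : ComputableIn W X := by
  obtain ⟨φ, Z, r, h₁, h₂, h₃⟩ := Df.exists_bind (Q := fun _ a => a ∈ W) h.df
  obtain rfl : Z = fun _ => X := funext h₂
  have h₄ (n c : M.Num) : n ∈ W ↔
      M.Sat (fun _ => X) (cons c (cons n (env r fun _ => 0))) (φ.ren id fun i => i + 1) := by
    rw [sat_ren]
    exact h₃ _ n
  have h₅ := (h₁ rfl).ren id fun i => i + 1
  exact ⟨_, _, ⟨_, h₅, rfl⟩, ⟨_, h₅, rfl⟩, env r fun _ => 0, fun n =>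
    ⟨⟨fun h => ⟨0, (h₄ n 0).1 h⟩, fun ⟨c, h⟩ => (h₄ n c).2 h⟩,
      ⟨fun h c => (h₄ n c).1 h, fun h => (h₄ n 0).2 (h 0)⟩⟩⟩

/-- The relative leftmost path principle for a nonempty `Π⁰₁` class, in which only competitors that
are `Σ⁰₀`-definable from the chosen element `f` are considered. -/
theorem Sigma0LPP.exists_leftmost (hLPP : M.Sigma0LPP) {Ψ : M.Num → Set M.Num → Prop}
    (hΨ : Df true M.sets fun ρ => Ψ (ρ 0) (seqGraph (ρ 1)))
    (huse : ∀ z X X', (∀ p, left p < z → (p ∈ X ↔ p ∈ X')) → Ψ z X → Ψ z X')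
    (h₀ : ∃ f, graph f ∈ M.sets ∧ ∀ z, Ψ z (graph f)) :
    ∃ f, graph f ∈ M.sets ∧ (∀ z, Ψ z (graph f)) ∧
      ∀ g, (∀ 𝒵 : Set (Set M.Num), Nonempty 𝒵 → FunDf true 𝒵 f → FunDf true 𝒵 g) →
        (∀ z, Ψ z (graph g)) → ∀ n, (∀ i, i < n → g i = f i) → ¬ g n < f n := by
  obtain ⟨T, hT, hpath⟩ := exists_tree hΨ huse
  obtain ⟨f₀, hf₀, hf₀Ψ⟩ := h₀
  obtain ⟨F, hF, hleft⟩ := hLPP T hT ⟨_, (hpath f₀ hf₀).2 hf₀Ψ⟩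
  obtain ⟨f, rfl⟩ := hF.1.exists_graph
  have hf : graph f ∈ M.sets := hF.1.1
  refine ⟨f, hf, (hpath f hf).1 hF, fun g hg hgΨ n hn hlt => hleft ⟨graph g, ?_, ?_, n, ?_, ?_⟩⟩
  · have := hg M.sets inferInstance (.of_graph_mem hf)
    exact (hpath g (graph_mem_sets g)).2 hgΨ
  · have := hg {join T (graph f)} inferInstance (.of_graph (setDf_join_right _ _))
    exact computableIn_of_setDf ⟨(inferInstance : Df true _ fun ρ => g (left (ρ 0)) = right (ρ 0))⟩
  · intro i hi v
    rw [pairMem_graph, pairMem_graph, hn i hi]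
  · exact ⟨g n, f n, pairMem_graph.2 rfl, pairMem_graph.2 rfl, hlt⟩

end Trees

/-! ### `Σ⁰₁` hierarchies -/

section Hierarchy

variable [hM : Fact M.RCA0]

/-- The part of `Y` on the levels that precede `j`; the level of `e` is its second component. -/
def restrict (prec : M.Num → M.Num → Prop) (Y : Set M.Num) (j : M.Num) : Set M.Num :=
  {e | e ∈ Y ∧ prec (right e) j}

/-- `B` is a matrix for a `Σ⁰₁` recursion along the transitive relation `prec`: both are
`Σ⁰₀`-definable from the parameter `P`, and `B e k X` depends only on the part of `X` below `k`.
In a hierarchy `Y` for `B`, the elements of level `j` are the `e` such that `B e k X` for some `k`,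
where `X` consists of the levels of `Y` that precede `j`. -/
structure IsMatrix (P : Set M.Num) (prec : M.Num → M.Num → Prop)
    (B : M.Num → M.Num → Set M.Num → Prop) : Prop where
  mem_sets : P ∈ M.sets
  df_prec : ∀ (𝒵 : Set (Set M.Num)) [Nonempty 𝒵] [SetDf true 𝒵 P],
    Df true 𝒵 fun ρ => prec (ρ 0) (ρ 1)
  df_matrix : ∀ (𝒵 : Set (Set M.Num)) [Nonempty 𝒵] [SetDf true 𝒵 P]
    (X : (ℕ → M.Num) → Set M.Num), (Df true 𝒵 fun ρ => ρ 0 ∈ X fun n => ρ (n + 1)) →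
      Df true 𝒵 fun ρ => B (ρ 0) (ρ 1) (X ρ)
  use : ∀ e k X X', (∀ d, d < k → (d ∈ X ↔ d ∈ X')) → B e k X → B e k X'
  trans : ∀ i j k, prec i j → prec j k → prec i k

/-- The hierarchy that the function with graph `X` supplies for the claim `q`, below level `j`. -/
def claimSet (prec : M.Num → M.Num → Prop) (X : Set M.Num) (q j : M.Num) : Set M.Num :=
  {e | pair (pair q e * 3 + 2) 0 ∉ X ∧ prec (right e) j}

/-- A function `f` is a *record* if it consists of the following data: `f (3 n)` tells whether
`n ∈ P`; `f (3 q + 1) = 0` is the claim that `q` does not belong to the hierarchy; and if this claim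
is made, the values `f (3 (q, e) + 2)` support it, by describing a hierarchy below the level of `q`
according to which the claim is correct. The value at `e` is `0` if `e` is not in that hierarchy and
otherwise `k + 1`, where `k` is a witness for `e`. -/
structure IsRecord (P : Set M.Num) (prec : M.Num → M.Num → Prop)
    (B : M.Num → M.Num → Set M.Num → Prop) (f : M.Num → M.Num) : Prop where
  param : ∀ n, (n ∈ P → f (n * 3) = 1) ∧ (n ∉ P → f (n * 3) = 0)
  absent : ∀ q, f (q * 3 + 1) = 0 → ∀ e, prec (right e) (right q) → f (pair q e * 3 + 2) = 0 →
    ∀ k, ¬ B e k (claimSet prec (graph f) q (right e))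
  witness : ∀ q, f (q * 3 + 1) = 0 → ∀ e, prec (right e) (right q) →
    ∀ k, f (pair q e * 3 + 2) = k + 1 → B e k (claimSet prec (graph f) q (right e))
  claim : ∀ q, f (q * 3 + 1) = 0 → ∀ k, ¬ B q k (claimSet prec (graph f) q (right q))

/-- The part of the definition of a record that concerns arguments below `z`, for the function with
graph `X`. All quantifiers are bounded by `z`, and only values at arguments below `z` matter. -/
def RecordBelow (P : Set M.Num) (prec : M.Num → M.Num → Prop)
    (B : M.Num → M.Num → Set M.Num → Prop) (z : M.Num) (X : Set M.Num) : Prop :=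
  (∀ n, n < z → n * 3 < z → (n ∈ P → pair (n * 3) 1 ∈ X) ∧ (n ∉ P → pair (n * 3) 0 ∈ X)) ∧
  ∀ q, q < z → ∀ e, e < z → ∀ k, k < z → q * 3 + 1 < z → pair q e * 3 + 2 < z →
    pair q k * 3 + 2 < z → pair (q * 3 + 1) 0 ∈ X →
      (prec (right e) (right q) →
        (pair (pair q e * 3 + 2) 0 ∈ X → ¬ B e k (claimSet prec X q (right e))) ∧
        (pair (pair q e * 3 + 2) (k + 1) ∈ X → B e k (claimSet prec X q (right e)))) ∧
      ¬ B q k (claimSet prec X q (right q))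

theorem pair_mem_graph {f : M.Num → M.Num} {i v : M.Num} : pair i v ∈ graph f ↔ f i = v := by
  simp [graph]

theorem mem_claimSet_graph {prec : M.Num → M.Num → Prop} {f : M.Num → M.Num} {q j e : M.Num} :
    e ∈ claimSet prec (graph f) q j ↔ f (pair q e * 3 + 2) ≠ 0 ∧ prec (right e) j := by
  simp [claimSet, pair_mem_graph]

variable {P : Set M.Num} {prec : M.Num → M.Num → Prop} {B : M.Num → M.Num → Set M.Num → Prop}

theorem isRecord_iff {f : M.Num → M.Num} :
    IsRecord P prec B f ↔ ∀ z, RecordBelow P prec B z (graph f) := by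
  simp only [RecordBelow, pair_mem_graph]
  constructor
  · intro h z
    refine ⟨fun n _ _ => h.param n, fun q _ e _ k _ _ _ _ hq => ⟨fun he => ⟨fun h' => ?_, ?_⟩, ?_⟩⟩
    · exact h.absent q hq e he h' k
    · exact h.witness q hq e he k
    · exact h.claim q hq k
  · intro h
    have key (q e k : M.Num) (hq : f (q * 3 + 1) = 0) := by
      refine (h (q + e + k + (q * 3 + 1) + (pair q e * 3 + 2) + (pair q k * 3 + 2) + 1)).2 q ?_ e ?_
        k ?_ ?_ ?_ ?_ hq
      all_goals rw [lt_add_one_iff_le]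
      · exact (num_le_iff _ _).2 ⟨_, by simp only [add_assoc]; rfl⟩
      · exact (num_le_iff _ _).2
          ⟨q + k + (q * 3 + 1) + (pair q e * 3 + 2) + (pair q k * 3 + 2), by ring⟩
      · exact (num_le_iff _ _).2
          ⟨q + e + (q * 3 + 1) + (pair q e * 3 + 2) + (pair q k * 3 + 2), by ring⟩
      · exact (num_le_iff _ _).2
          ⟨q + e + k + (pair q e * 3 + 2) + (pair q k * 3 + 2), by ring⟩
      · exact (num_le_iff _ _).2
          ⟨q + e + k + (q * 3 + 1) + (pair q k * 3 + 2), by ring⟩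
      · exact le_add_self
    refine ⟨fun n => (h (n + n * 3 + 1)).1 n ?_ ?_,
      fun q hq e he h₀ k => ((key q e k hq).1 he).1 h₀,
      fun q hq e he k hk => ((key q e k hq).1 he).2 hk, fun q hq k => (key q 0 k hq).2⟩
    · exact (lt_add_one_iff_le _ _).2 le_self_add
    · exact (lt_add_one_iff_le _ _).2 le_add_self

/-- Whether `RecordBelow` holds depends only on the values at arguments below `z`: a matrix with
bound `k` uses the supporting hierarchy below `k`, which is stored at positions up to that of
`(q, k)`. -/
theorem IsMatrix.recordBelow_use (hB : IsMatrix P prec B) (z : M.Num) (X X' : Set M.Num)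
    (h : ∀ p, left p < z → (p ∈ X ↔ p ∈ X')) (hX : RecordBelow P prec B z X) :
    RecordBelow P prec B z X' := by
  have h' {i : M.Num} (v : M.Num) (hi : i < z) : pair i v ∈ X' ↔ pair i v ∈ X :=
    (h _ (by rwa [left_pair])).symm
  have hset {q k : M.Num} (hk : pair q k * 3 + 2 < z) (e j : M.Num) :
      B e k (claimSet prec X' q j) ↔ B e k (claimSet prec X q j) := by
    have (d : M.Num) (hd : d < k) : d ∈ claimSet prec X' q j ↔ d ∈ claimSet prec X q j := by
      have hle : pair q d * 3 + 2 ≤ pair q k * 3 + 2 :=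
        add_le_add_left (mul_le_mul' (pair_le_pair_right q hd.le) le_rfl) _
      simp only [claimSet, Set.mem_ofPred_eq, h' 0 (hle.trans_lt hk)]
    exact ⟨hB.use _ _ _ _ this, hB.use _ _ _ _ fun d hd => (this d hd).symm⟩
  refine ⟨fun n hn hn' => ?_, fun q hq e he k hk h₁ h₂ h₃ => ?_⟩
  · rw [h' _ hn', h' _ hn']
    exact hX.1 n hn hn'
  · rw [h' _ h₁, h' _ h₂, h' _ h₂, hset h₃, hset h₃]
    exact hX.2 q hq e he k hk h₁ h₂ h₃

set_option synthInstance.maxSize 1000 in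
set_option synthInstance.maxHeartbeats 200000 in
theorem IsMatrix.df_recordBelow (hB : IsMatrix P prec B) :
    Df true M.sets fun ρ => RecordBelow P prec B (ρ 0) (seqGraph (ρ 1)) := by
  have : SetDf true M.sets P := .of_mem hB.mem_sets
  have h₁ (f g : (ℕ → M.Num) → M.Num) [Fn true M.sets f] [Fn true M.sets g] :
      Df true M.sets fun ρ => prec (f ρ) (g ρ) := Df.comp₂ (hB.df_prec M.sets) f g
  have h₂ : Df true M.sets fun ρ => B (ρ 0) (ρ 1) (claimSet prec (seqGraph (ρ 2)) (ρ 3) (ρ 4)) := by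
    refine hB.df_matrix M.sets (fun ρ => claimSet prec (seqGraph (ρ 2)) (ρ 3) (ρ 4)) ?_
    have h : Df true M.sets fun ρ => ¬ Entry (ρ 3) (pair (ρ 4) (ρ 0) * 3 + 2) 0 ∧
        prec (right (ρ 0)) (ρ 5) := inferInstance
    exact .of_iff (hP := h) _ fun ρ => by simp [claimSet, seqGraph]
  have h₃ (f g h k l : (ℕ → M.Num) → M.Num) [Fn true M.sets f] [Fn true M.sets g]
      [Fn true M.sets h] [Fn true M.sets k] [Fn true M.sets l] :
      Df true M.sets fun ρ => B (f ρ) (g ρ) (claimSet prec (seqGraph (h ρ)) (k ρ) (l ρ)) :=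
    Df.comp₅ (P := fun x y z w v => B x y (claimSet prec (seqGraph z) w v)) h₂ f g h k l
  have h₄ (f g h : (ℕ → M.Num) → M.Num) [Fn true M.sets f] [Fn true M.sets g]
      [Fn true M.sets h] : Df true M.sets fun ρ => pair (f ρ) (g ρ) ∈ seqGraph (h ρ) :=
    .of_iff (fun ρ => Entry (h ρ) (f ρ) (g ρ)) fun ρ => by simp [seqGraph]
  unfold RecordBelow
  infer_instance

theorem mul_three_add_inj {a c i j : M.Num} (hi : i < 3) (hj : j < 3) :
    a * 3 + i = c * 3 + j ↔ a = c ∧ i = j := by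
  refine ⟨fun h => ?_, fun ⟨h, h'⟩ => by rw [h, h']⟩
  obtain rfl := eq_of_mul_add_eq hi hj h
  have := add_right_cancel h
  exact ⟨mul_right_cancel₀ (by norm_num) this, rfl⟩

/-- There is a record, namely the one without any claims. -/
theorem IsMatrix.exists_record (hB : IsMatrix P prec B) :
    ∃ f, graph f ∈ M.sets ∧ IsRecord P prec B f := by
  classical
  have : SetDf true M.sets P := .of_mem hB.mem_sets
  let f : M.Num → M.Num := fun p => if ∃ n, n < p + 1 ∧ p = n * 3 ∧ n ∉ P then 0 else 1
  have hf : FunDf true M.sets f := by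
    refine ⟨.of_iff (fun ρ => ((∃ n, n < ρ 0 + 1 ∧ ρ 0 = n * 3 ∧ n ∉ P) ∧ ρ 1 = 0) ∨
      (¬ (∃ n, n < ρ 0 + 1 ∧ ρ 0 = n * 3 ∧ n ∉ P) ∧ ρ 1 = 1)) fun ρ => ?_⟩
    simp only [f]
    split_ifs with h
    · simp only [h, true_and, not_true, false_and, or_false, eq_comm]
    · simp only [h, false_and, not_false_iff, true_and, false_or, eq_comm]
  have hclaim (q : M.Num) : f (q * 3 + 1) ≠ 0 := by
    have : ¬ ∃ n, n < q * 3 + 1 + 1 ∧ q * 3 + 1 = n * 3 ∧ n ∉ P := by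
      rintro ⟨n, -, h, -⟩
      rw [← add_zero (n * 3), mul_three_add_inj (by norm_num) (by norm_num)] at h
      exact one_ne_zero h.2
    simp only [f, this, if_false]
    exact one_ne_zero
  refine ⟨f, graph_mem_sets f, ⟨fun n => ⟨fun hn => ?_, fun hn => ?_⟩,
    fun q hq => (hclaim q hq).elim, fun q hq => (hclaim q hq).elim,
    fun q hq => (hclaim q hq).elim⟩⟩
  · refine if_neg ?_
    rintro ⟨m, -, h, hm⟩
    rw [← add_zero (n * 3), ← add_zero (m * 3), mul_three_add_inj (by norm_num) (by norm_num)] at h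
    exact hm (h.1 ▸ hn)
  · exact if_pos ⟨n, (lt_add_one_iff_le _ _).2 (le_mul_of_pos _ (by norm_num)), rfl, hn⟩

omit hM in
theorem Df.of_bounded {𝒵 : Set (Set M.Num)} {b : Bool} {Q : (ℕ → M.Num) → Prop}
    (hQ : Df true 𝒵 Q) : Df b 𝒵 Q := by
  obtain ⟨φ, Z, r, h₁, h₂⟩ := hQ
  exact ⟨φ, Z, r, fun _ => h₁ rfl, h₂⟩

variable (M) in
/-- Transfinite induction along `prec` for arithmetical predicates. -/
def ArithInduction (prec : M.Num → M.Num → Prop) : Prop :=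
  ∀ Q : M.Num → Prop, (Df false M.sets fun ρ => Q (ρ 0)) →
    (∀ j, (∀ i, prec i j → Q i) → Q j) → ∀ j, Q j

/-- The elements that `f` does not claim to be absent. -/
def present (f : M.Num → M.Num) : Set M.Num := {e | f (e * 3 + 1) ≠ 0}

instance present_setDf {b : Bool} {𝒵 : Set (Set M.Num)} [Nonempty 𝒵] {f : M.Num → M.Num}
    [FunDf b 𝒵 f] : SetDf b 𝒵 (present f) :=
  ⟨(inferInstance : Df b 𝒵 fun ρ => f (ρ 0 * 3 + 1) ≠ 0)⟩

/-- The level of `e` in `Y` is as required by the matrix `B`. -/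
def Correct (prec : M.Num → M.Num → Prop) (B : M.Num → M.Num → Set M.Num → Prop)
    (Y : Set M.Num) (e : M.Num) : Prop :=
  e ∈ Y ↔ ∃ k, B e k (restrict prec Y (right e))

theorem IsMatrix.df_restrict (hB : IsMatrix P prec B) {𝒵 : Set (Set M.Num)} [Nonempty 𝒵]
    [SetDf true 𝒵 P] {Y : Set M.Num} [SetDf true 𝒵 Y] :
    Df true 𝒵 fun ρ => B (ρ 0) (ρ 1) (restrict prec Y (right (ρ 0))) := by
  have h₁ : Df true 𝒵 fun ρ => prec (right (ρ 0)) (right (ρ 1)) :=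
    Df.comp₂ (hB.df_prec 𝒵) (fun ρ => right (ρ 0)) fun ρ => right (ρ 1)
  have h₂ : Df true 𝒵 fun ρ => ρ 0 ∈ Y ∧ prec (right (ρ 0)) (right (ρ 1)) := inferInstance
  exact hB.df_matrix 𝒵 (fun ρ => restrict prec Y (right (ρ 0))) h₂

/-- If the levels below that of `q` are correct, the hierarchy that supports the claim that `q` is
absent agrees with them. Consequently, the claim is true. -/
theorem IsRecord.claimSet_eq (hB : IsMatrix P prec B) (hTI : M.ArithInduction prec)
    {f : M.Num → M.Num} (hf : graph f ∈ M.sets) (hr : IsRecord P prec B f) {q : M.Num}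
    (hq : f (q * 3 + 1) = 0)
    (hY : ∀ e, prec (right e) (right q) → Correct prec B (present f) e) :
    claimSet prec (graph f) q (right q) = restrict prec (present f) (right q) := by
  have : SetDf true M.sets (graph f) := .of_mem hf
  have : FunDf true M.sets f := .of_graph this
  have : FunDf false M.sets f := .of_graph (.of_mem hf)
  have : SetDf true M.sets P := .of_mem hB.mem_sets
  have hprec : Df false M.sets fun ρ => prec (ρ 0) (ρ 1) := (hB.df_prec M.sets).of_bounded
  have hprec' : Df false M.sets fun ρ => prec (ρ 0) (right q) :=
    Df.comp₂ hprec (fun ρ => ρ 0) fun _ => right q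
  have key := hTI (fun i => prec i (right q) → ∀ e, right e = i →
    (f (pair q e * 3 + 2) ≠ 0 ↔ e ∈ present f)) inferInstance ?_
  · ext e
    rw [mem_claimSet_graph]
    exact and_congr_left fun he => key _ he e rfl
  · rintro i ih hi e rfl
    have hset : claimSet prec (graph f) q (right e) = restrict prec (present f) (right e) := by
      ext d
      rw [mem_claimSet_graph]
      exact and_congr_left fun hd => ih _ hd (hB.trans _ _ _ hd hi) d rfl
    have h₁ := hr.absent q hq e hi
    have h₂ := hr.witness q hq e hi
    rw [hset] at h₁ h₂
    rw [show e ∈ present f ↔ _ from hY e hi]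
    rcases num_eq_zero_or_succ (f (pair q e * 3 + 2)) with h | ⟨k, h⟩
    · simp only [h, ne_eq, not_true, false_iff, not_exists]
      exact h₁ h
    · refine iff_of_true ?_ ⟨k, h₂ k h⟩
      rw [h]
      exact hM.out.basic.succ_ne_zero k

/-- If the levels of `Y` below `j` are correct, the least witnesses for them form a function. -/
theorem IsMatrix.exists_witness (hB : IsMatrix P prec B) {Y : Set M.Num} (hYs : Y ∈ M.sets)
    {j : M.Num} (hY : ∀ e, prec (right e) j → Correct prec B Y e) (e : M.Num) :
    ∃ v, (prec (right e) j ∧ e ∈ Y ∧ ∃ k, k < v ∧ v = k + 1 ∧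
      B e k (restrict prec Y (right e)) ∧ ∀ d, d < k → ¬ B e d (restrict prec Y (right e))) ∨
      (¬ (prec (right e) j ∧ e ∈ Y) ∧ v = 0) := by
  by_cases h : prec (right e) j ∧ e ∈ Y
  · have : SetDf true M.sets P := .of_mem hB.mem_sets
    have : SetDf true M.sets Y := .of_mem hYs
    have hdf := hB.df_restrict (𝒵 := M.sets) (Y := Y)
    obtain ⟨k, hk, hmin⟩ := delta0_exists_least
      (P := fun k => B e k (restrict prec Y (right e)))
      (Df.comp₂ (P := fun x y => B x y (restrict prec Y (right x))) hdf (fun _ => e) fun ρ => ρ 0)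
      ((hY e h.1).1 h.2)
    exact ⟨k + 1, .inl ⟨h.1, h.2, k, (lt_add_one_iff_le _ _).2 le_rfl, rfl, hk, hmin⟩⟩
  · exact ⟨0, .inr ⟨h, rfl⟩⟩

set_option synthInstance.maxSize 1000 in
set_option synthInstance.maxHeartbeats 200000 in
/-- Suppose that the levels below that of `q` are correct, but `f` fails to make the correct claim
that `q` is absent. Then making this claim, supported by `f` itself, and dropping all later claims
leads to a record to the left of `f`, which is computable from `f`. -/
theorem IsRecord.exists_competitor (hB : IsMatrix P prec B) {f : M.Num → M.Num}
    (hf : graph f ∈ M.sets) (hrec : IsRecord P prec B f) {q : M.Num}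
    (hY : ∀ e, prec (right e) (right q) → Correct prec B (present f) e)
    (hq : ∀ k, ¬ B q k (restrict prec (present f) (right q))) :
    ∃ g, (∀ 𝒵 : Set (Set M.Num), Nonempty 𝒵 → FunDf true 𝒵 f → FunDf true 𝒵 g) ∧
      IsRecord P prec B g ∧ (∀ i, i < q * 3 + 1 → g i = f i) ∧ g (q * 3 + 1) = 0 := by
  classical
  have : FunDf true M.sets f := .of_graph_mem hf
  have hYs : present f ∈ M.sets := setOf_mem_sets (P := fun e => e ∈ present f) inferInstance
  choose w hw using hB.exists_witness hYs hY
  have h0 : (0 : M.Num) < 3 := by norm_num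
  have h1 : (1 : M.Num) < 3 := by norm_num
  have h2 : (2 : M.Num) < 3 := by norm_num
  have h01 : (0 : M.Num) ≠ 1 := zero_ne_one
  have h02 : (0 : M.Num) ≠ 2 := by norm_num
  have h12 : (1 : M.Num) ≠ 2 := by norm_num
  -- The value `w e` is `k + 1` if `e` is present and has the least witness `k`, and otherwise `0`.
  let g : M.Num → M.Num := fun p =>
    if p = q * 3 + 1 then 0
    else if ∃ r, q < r ∧ p = r * 3 + 1 then 1
    else if h : ∃ e, p = pair q e * 3 + 2 then w h.choose
    else f p
  have hg₁ : g (q * 3 + 1) = 0 := if_pos rfl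
  have hg₂ {r : M.Num} (hr : q < r) : g (r * 3 + 1) = 1 := by
    have : r * 3 + 1 ≠ q * 3 + 1 := fun h => hr.ne' ((mul_three_add_inj h1 h1).1 h).1
    simp only [g, if_neg this]
    exact if_pos ⟨r, hr, rfl⟩
  have hg₃ (e : M.Num) : g (pair q e * 3 + 2) = w e := by
    have h₁ : pair q e * 3 + 2 ≠ q * 3 + 1 := fun h => h12 ((mul_three_add_inj h2 h1).1 h).2.symm
    have h₂ : ¬ ∃ r, q < r ∧ pair q e * 3 + 2 = r * 3 + 1 := fun ⟨r, _, h⟩ =>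
      h12 ((mul_three_add_inj h2 h1).1 h).2.symm
    have h₃ : ∃ d, pair q e * 3 + 2 = pair q d * 3 + 2 := ⟨e, rfl⟩
    simp only [g, if_neg h₁, if_neg h₂, dif_pos h₃]
    have h₄ := h₃.choose_spec
    rw [mul_three_add_inj h2 h2, pair_inj] at h₄
    rw [← h₄.1.2]
  have hg₄ {p : M.Num} (h₁ : p ≠ q * 3 + 1) (h₂ : ¬ ∃ r, q < r ∧ p = r * 3 + 1)
      (h₃ : ¬ ∃ e, p = pair q e * 3 + 2) : g p = f p := by
    simp only [g, if_neg h₁, if_neg h₂, dif_neg h₃]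
  have hparam (n : M.Num) : g (n * 3) = f (n * 3) := by
    refine hg₄ ?_ ?_ ?_
    · rw [← add_zero (n * 3)]
      exact fun h => h01 ((mul_three_add_inj h0 h1).1 h).2
    · rw [← add_zero (n * 3)]
      exact fun ⟨r, _, h⟩ => h01 ((mul_three_add_inj h0 h1).1 h).2
    · rw [← add_zero (n * 3)]
      exact fun ⟨e, h⟩ => h02 ((mul_three_add_inj h0 h2).1 h).2
  have hclaim {r : M.Num} (hr : r < q) : g (r * 3 + 1) = f (r * 3 + 1) := by
    refine hg₄ ?_ ?_ ?_
    · exact fun h => hr.ne ((mul_three_add_inj h1 h1).1 h).1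
    · exact fun ⟨s, hs, h⟩ => (hr.trans hs).ne ((mul_three_add_inj h1 h1).1 h).1
    · exact fun ⟨e, h⟩ => h12 ((mul_three_add_inj h1 h2).1 h).2
  have hdata {r : M.Num} (hr : r < q) (e : M.Num) :
      g (pair r e * 3 + 2) = f (pair r e * 3 + 2) := by
    refine hg₄ ?_ ?_ ?_
    · exact fun h => h12 ((mul_three_add_inj h2 h1).1 h).2.symm
    · exact fun ⟨s, hs, h⟩ => h12 ((mul_three_add_inj h2 h1).1 h).2.symm
    · exact fun ⟨d, h⟩ => hr.ne (pair_inj.1 ((mul_three_add_inj h2 h2).1 h).1).1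
  have hpos (k : M.Num) : k + 1 ≠ 0 := hM.out.basic.succ_ne_zero k
  have hw0 (e : M.Num) (he : prec (right e) (right q)) : w e ≠ 0 ↔ e ∈ present f := by
    rcases hw e with ⟨-, h, k, -, hk, -⟩ | ⟨h, hk⟩
    · exact iff_of_true (hk ▸ hpos k) h
    · exact iff_of_false (not_not.2 hk) fun h' => h ⟨he, h'⟩
  have hlt {r : M.Num} (hr : r < q) (j : M.Num) :
      claimSet prec (graph g) r j = claimSet prec (graph f) r j := by
    ext e
    rw [mem_claimSet_graph, mem_claimSet_graph, hdata hr]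
  have heq {j : M.Num} (hj : ∀ i, prec i j → prec i (right q)) :
      claimSet prec (graph g) q j = restrict prec (present f) j := by
    ext e
    rw [mem_claimSet_graph, hg₃]
    exact and_congr_left fun he => hw0 e (hj _ he)
  have hcases {r : M.Num} (hr : g (r * 3 + 1) = 0) : (r < q ∧ f (r * 3 + 1) = 0) ∨ r = q := by
    rcases lt_trichotomy r q with h | h | h
    · exact .inl ⟨h, hclaim h ▸ hr⟩
    · exact .inr h
    · exact (h01 (hr.symm.trans (hg₂ h))).elim
  refine ⟨g, fun 𝒵 _ _ => ?_, ⟨fun n => hparam n ▸ hrec.param n, ?_, ?_, ?_⟩, fun i hi => ?_, hg₁⟩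
  · -- The parameter `P` can be read off from the record `f`.
    have : SetDf true 𝒵 P := by
      refine ⟨.of_iff (fun ρ => f (ρ 0 * 3) = 1) fun ρ => ⟨(hrec.param _).1, fun h => ?_⟩⟩
      by_contra h'
      exact h01 (((hrec.param _).2 h').symm.trans h)
    have h₁ (f g : (ℕ → M.Num) → M.Num) [Fn true 𝒵 f] [Fn true 𝒵 g] :
        Df true 𝒵 fun ρ => prec (f ρ) (g ρ) := Df.comp₂ (hB.df_prec 𝒵) f g
    have h₂ (f' g' : (ℕ → M.Num) → M.Num) [Fn true 𝒵 f'] [Fn true 𝒵 g'] :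
        Df true 𝒵 fun ρ => B (f' ρ) (g' ρ) (restrict prec (present f) (right (f' ρ))) :=
      Df.comp₂ (P := fun x y => B x y (restrict prec (present f) (right x)))
        (hB.df_restrict (𝒵 := 𝒵) (Y := present f)) f' g'
    have hwv (e v : M.Num) : w e = v ↔ (prec (right e) (right q) ∧ e ∈ present f ∧
        ∃ k, k < v ∧ v = k + 1 ∧ B e k (restrict prec (present f) (right e)) ∧
          ∀ d, d < k → ¬ B e d (restrict prec (present f) (right e))) ∨
        (¬ (prec (right e) (right q) ∧ e ∈ present f) ∧ v = 0) := by
      constructor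
      · rintro rfl
        exact hw e
      · rintro (⟨h₁, h₂, k, -, rfl, hk, hmin⟩ | ⟨h, rfl⟩)
        · rcases hw e with ⟨-, -, k', -, hk', hk'', hmin'⟩ | ⟨h, -⟩
          · rw [hk']
            rcases lt_trichotomy k k' with h | rfl | h
            exacts [(hmin' k h hk).elim, rfl, (hmin k' h hk'').elim]
          · exact (h ⟨h₁, h₂⟩).elim
        · rcases hw e with ⟨h₁, h₂, -⟩ | ⟨-, h'⟩
          exacts [(h ⟨h₁, h₂⟩).elim, h']
    have hdf : Df true 𝒵 fun ρ => (ρ 0 = q * 3 + 1 ∧ ρ 1 = 0) ∨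
        (∃ r, r < ρ 0 + 1 ∧ q < r ∧ ρ 0 = r * 3 + 1 ∧ ρ 1 = 1) ∨
        (∃ e, e < ρ 0 + 1 ∧ ρ 0 = pair q e * 3 + 2 ∧
          ((prec (right e) (right q) ∧ e ∈ present f ∧
            ∃ k, k < ρ 1 ∧ ρ 1 = k + 1 ∧ B e k (restrict prec (present f) (right e)) ∧
            ∀ d, d < k → ¬ B e d (restrict prec (present f) (right e))) ∨
          (¬ (prec (right e) (right q) ∧ e ∈ present f) ∧ ρ 1 = 0))) ∨
        (ρ 0 ≠ q * 3 + 1 ∧ (¬ ∃ r, r < ρ 0 + 1 ∧ q < r ∧ ρ 0 = r * 3 + 1) ∧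
          (¬ ∃ e, e < ρ 0 + 1 ∧ ρ 0 = pair q e * 3 + 2) ∧ f (ρ 0) = ρ 1) := inferInstance
    refine ⟨.of_iff (hP := hdf) _ fun ρ => ?_⟩
    have hb₁ {r p : M.Num} (h : p = r * 3 + 1) : r < p + 1 := by
      rw [h, lt_add_one_iff_le]
      exact (le_mul_of_pos r h0).trans le_self_add
    have hb₂ {e p : M.Num} (h : p = pair q e * 3 + 2) : e < p + 1 := by
      rw [h, lt_add_one_iff_le]
      exact (right_le_pair q e).trans ((le_mul_of_pos _ h0).trans le_self_add)
    simp only [← hwv]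
    by_cases c₁ : ρ 0 = q * 3 + 1
    · rw [c₁, hg₁]
      constructor
      · exact fun h => .inl ⟨rfl, h.symm⟩
      · rintro (h | ⟨r, -, h, h', -⟩ | ⟨e, -, h, -⟩ | ⟨h, -⟩)
        · exact h.2.symm
        · exact (h.ne ((mul_three_add_inj h1 h1).1 h').1).elim
        · exact (h12 ((mul_three_add_inj h1 h2).1 h).2).elim
        · exact (h rfl).elim
    by_cases c₂ : ∃ r, q < r ∧ ρ 0 = r * 3 + 1
    · obtain ⟨r, hr, h⟩ := c₂
      rw [h, hg₂ hr]
      rw [h] at c₁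
      constructor
      · exact fun h' => .inr (.inl ⟨r, hb₁ rfl, hr, rfl, h'.symm⟩)
      · rintro (h | ⟨r, -, h, h', h''⟩ | ⟨e, -, h, -⟩ | ⟨-, h, -⟩)
        · exact (c₁ h.1).elim
        · exact h''.symm
        · exact (h12 ((mul_three_add_inj h1 h2).1 h).2).elim
        · exact (h ⟨r, hb₁ rfl, hr, rfl⟩).elim
    by_cases c₃ : ∃ e, ρ 0 = pair q e * 3 + 2
    · obtain ⟨e, h⟩ := c₃
      rw [h, hg₃]
      rw [h] at c₁ c₂
      constructor
      · exact fun h' => .inr (.inr (.inl ⟨e, hb₂ rfl, rfl, h'⟩))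
      · rintro (h | ⟨r, -, h, h', -⟩ | ⟨d, -, h, h'⟩ | ⟨-, -, h, -⟩)
        · exact (c₁ h.1).elim
        · exact (c₂ ⟨r, h, h'⟩).elim
        · rwa [(pair_inj.1 ((mul_three_add_inj h2 h2).1 h).1).2]
        · exact (h ⟨e, hb₂ rfl, rfl⟩).elim
    · rw [hg₄ c₁ c₂ c₃]
      constructor
      · exact fun h => .inr (.inr (.inr ⟨c₁, fun ⟨r, _, h⟩ => c₂ ⟨r, h⟩,
          fun ⟨e, _, h⟩ => c₃ ⟨e, h⟩, h⟩))
      · rintro (h | ⟨r, -, h, h', -⟩ | ⟨d, -, h, h'⟩ | ⟨-, -, -, h⟩)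
        · exact (c₁ h.1).elim
        · exact (c₂ ⟨r, h, h'⟩).elim
        · exact (c₃ ⟨d, h⟩).elim
        · exact h
  · intro r hr e he h k
    rcases hcases hr with ⟨h', hfr⟩ | rfl
    · rw [hlt h']
      rw [hdata h'] at h
      exact hrec.absent r hfr e he h k
    · rw [heq fun i hi => hB.trans _ _ _ hi he]
      rw [hg₃] at h
      have : e ∉ present f := fun h' => (hw0 e he).2 h' h
      exact fun h' => this ((hY e he).2 ⟨k, h'⟩)
  · intro r hr e he k h
    rcases hcases hr with ⟨h', hfr⟩ | rfl
    · rw [hlt h']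
      rw [hdata h'] at h
      exact hrec.witness r hfr e he k h
    · rw [heq fun i hi => hB.trans _ _ _ hi he]
      rw [hg₃] at h
      rcases hw e with ⟨-, -, k', -, hk', h', -⟩ | ⟨-, h'⟩
      · rw [h] at hk'
        rwa [hM.out.basic.succ_inj _ _ hk']
      · exact (hpos k (h.symm.trans h')).elim
  · intro r hr k
    rcases hcases hr with ⟨h', hfr⟩ | rfl
    · rw [hlt h']
      exact hrec.claim r hfr k
    · rw [heq fun _ h => h]
      exact hq k
  · refine hg₄ hi.ne ?_ ?_
    · rintro ⟨r, hr, rfl⟩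
      exact absurd (add_lt_add_left (mul_lt_mul_of_pos_right hr h0) 1) hi.le.not_gt
    · rintro ⟨e, rfl⟩
      refine absurd hi (not_lt.2 ?_)
      exact add_le_add (mul_le_mul' (left_le_pair q e) le_rfl) (by norm_num)

/-- Recursion along `prec` for the `Σ⁰₁` matrix `B`: the set of all elements that a leftmost record
does not claim to be absent is a hierarchy. -/
theorem IsMatrix.exists_hierarchy (hLPP : M.Sigma0LPP) (hB : IsMatrix P prec B)
    (hTI : M.ArithInduction prec) :
    ∃ Y ∈ M.sets, ∀ e, e ∈ Y ↔ ∃ k, B e k (restrict prec Y (right e)) := by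
  obtain ⟨f₀, hf₀, hr₀⟩ := hB.exists_record
  obtain ⟨f, hf, hr, hleft⟩ := hLPP.exists_leftmost hB.df_recordBelow hB.recordBelow_use
    ⟨f₀, hf₀, isRecord_iff.1 hr₀⟩
  rw [← isRecord_iff] at hr
  have : FunDf true M.sets f := .of_graph_mem hf
  have : SetDf true M.sets P := .of_mem hB.mem_sets
  have hYs : present f ∈ M.sets := setOf_mem_sets (P := fun e => e ∈ present f) inferInstance
  have : SetDf false M.sets (present f) := .of_mem hYs
  have hdf : Df false M.sets fun ρ => B (ρ 0) (ρ 1) (restrict prec (present f) (right (ρ 0))) :=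
    hB.df_restrict.of_bounded
  refine ⟨present f, hYs, fun e => ?_⟩
  have key := hTI (fun j => ∀ e, right e = j → Correct prec B (present f) e) ?_ ?_ (right e) e rfl
  · exact key
  · have h₂ (f' g' : (ℕ → M.Num) → M.Num) [Fn false M.sets f'] [Fn false M.sets g'] :
        Df false M.sets fun ρ => B (f' ρ) (g' ρ) (restrict prec (present f) (right (f' ρ))) :=
      Df.comp₂ (P := fun x y => B x y (restrict prec (present f) (right x))) hdf f' g'
    unfold Correct
    infer_instance
  · rintro j ih q rfl
    have hY (e : M.Num) (he : prec (right e) (right q)) : Correct prec B (present f) e :=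
      ih _ he e rfl
    constructor
    · intro hq
      by_contra! hno
      obtain ⟨g, hgf, hg, hagree, hg0⟩ := hr.exists_competitor hB hf hY hno
      refine hleft g hgf (isRecord_iff.1 hg) _ hagree ?_
      rw [hg0]
      exact pos_iff_ne_zero.2 hq
    · rintro ⟨k, hk⟩ hq
      refine hr.claim q hq k ?_
      rwa [hr.claimSet_eq hB hTI hf hq hY]

end Hierarchy

end L2Structure

/-! ### Arithmetical comprehension -/

/-- Formulas whose only logical operations are `nand` and unbounded existential quantification; they
have the expressive power of all arithmetical formulas. -/
inductive Core : Type
  | eq (s t : NumTerm) : Core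
  | lt (s t : NumTerm) : Core
  | mem (t : NumTerm) (k : ℕ) : Core
  | nand (φ ψ : Core) : Core
  | ex (φ : Core) : Core

/-- The negation of a core formula. -/
def Core.neg (φ : Core) : Core := nand φ φ

/-- The translation of arithmetical formulas into core formulas. -/
def ArithFormula.toCore : ArithFormula → Core
  | eq s t => .eq s t
  | lt s t => .lt s t
  | mem t k => .mem t k
  | neg φ => φ.toCore.neg
  | and φ ψ => (Core.nand φ.toCore ψ.toCore).neg
  | or φ ψ => .nand φ.toCore.neg ψ.toCore.neg
  | ball t φ => (Core.ex (Core.nand (.lt (.var 0) (t.ren (· + 1))) φ.toCore.neg).neg).neg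
  | bex t φ => .ex (Core.nand (.lt (.var 0) (t.ren (· + 1))) φ.toCore).neg
  | all φ => (Core.ex φ.toCore.neg).neg
  | ex φ => .ex φ.toCore

namespace L2Structure

variable {M : L2Structure.{u}}

variable (M) in
/-- Truth of a core formula. -/
def CoreSat (Z : ℕ → Set M.Num) : (ℕ → M.Num) → Core → Prop
  | ρ, .eq s t => M.termVal ρ s = M.termVal ρ t
  | ρ, .lt s t => M.termVal ρ s < M.termVal ρ t
  | ρ, .mem t k => M.termVal ρ t ∈ Z k
  | ρ, .nand φ ψ => ¬ (CoreSat Z ρ φ ∧ CoreSat Z ρ ψ)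
  | ρ, .ex φ => ∃ a : M.Num, CoreSat Z (cons a ρ) φ

theorem coreSat_neg {Z : ℕ → Set M.Num} {ρ : ℕ → M.Num} {φ : Core} :
    M.CoreSat Z ρ φ.neg ↔ ¬ M.CoreSat Z ρ φ := by
  simp [Core.neg, CoreSat]

theorem coreSat_toCore (Z : ℕ → Set M.Num) (ρ : ℕ → M.Num) (φ : ArithFormula) :
    M.CoreSat Z ρ φ.toCore ↔ M.Sat Z ρ φ := by
  have hshift (ρ : ℕ → M.Num) (a : M.Num) (t : NumTerm) :
      M.termVal (cons a ρ) (t.ren (· + 1)) = M.termVal ρ t := termVal_ren _ _ _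
  induction φ generalizing ρ with
  | eq | lt | mem => rfl
  | neg φ ih => simp only [ArithFormula.toCore, coreSat_neg, Sat, ih]
  | and φ ψ ih₁ ih₂ =>
    simp only [ArithFormula.toCore, coreSat_neg, Sat, CoreSat, ih₁, ih₂, not_not]
  | or φ ψ ih₁ ih₂ =>
    simp only [ArithFormula.toCore, coreSat_neg, Sat, CoreSat, ih₁, ih₂]
    tauto
  | ball t φ ih =>
    simp only [ArithFormula.toCore, coreSat_neg, Sat, CoreSat, ih, termVal.eq_1, hshift]
    simp [cons]
  | bex t φ ih =>
    simp only [ArithFormula.toCore, coreSat_neg, Sat, CoreSat, ih, termVal.eq_1, hshift]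
    simp [cons]
  | all φ ih =>
    simp only [ArithFormula.toCore, coreSat_neg, Sat, CoreSat, ih]
    simp
  | ex φ ih => simp only [ArithFormula.toCore, Sat, CoreSat, ih]

theorem exists_termVal_congr (t : NumTerm) : ∃ d : ℕ, ∀ ρ ρ' : ℕ → M.Num,
    (∀ i < d, ρ i = ρ' i) → M.termVal ρ t = M.termVal ρ' t := by
  induction t with
  | var i => exact ⟨i + 1, fun _ _ h => h i i.lt_succ_self⟩
  | zero | one => exact ⟨0, fun _ _ _ => rfl⟩
  | add s t ih₁ ih₂ =>
    obtain ⟨c, hc⟩ := ih₁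
    obtain ⟨d, hd⟩ := ih₂
    refine ⟨c + d, fun ρ ρ' h => ?_⟩
    simp only [termVal, hc ρ ρ' fun i hi => h i (by omega), hd ρ ρ' fun i hi => h i (by omega)]
  | mul s t ih₁ ih₂ =>
    obtain ⟨c, hc⟩ := ih₁
    obtain ⟨d, hd⟩ := ih₂
    refine ⟨c + d, fun ρ ρ' h => ?_⟩
    simp only [termVal, hc ρ ρ' fun i hi => h i (by omega), hd ρ ρ' fun i hi => h i (by omega)]

/-- The truth of a formula depends only on the values of finitely many variables. -/
theorem exists_coreSat_congr (φ : Core) : ∃ d : ℕ, ∀ (Z Z' : ℕ → Set M.Num) (ρ ρ' : ℕ → M.Num),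
    (∀ i < d, Z i = Z' i) → (∀ i < d, ρ i = ρ' i) → (M.CoreSat Z ρ φ ↔ M.CoreSat Z' ρ' φ) := by
  induction φ with
  | eq s t =>
    obtain ⟨c, hc⟩ := exists_termVal_congr (M := M) s
    obtain ⟨d, hd⟩ := exists_termVal_congr (M := M) t
    refine ⟨c + d, fun _ _ ρ ρ' _ h => ?_⟩
    simp only [CoreSat, hc ρ ρ' fun i hi => h i (by omega), hd ρ ρ' fun i hi => h i (by omega)]
  | lt s t =>
    obtain ⟨c, hc⟩ := exists_termVal_congr (M := M) s
    obtain ⟨d, hd⟩ := exists_termVal_congr (M := M) t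
    refine ⟨c + d, fun _ _ ρ ρ' _ h => ?_⟩
    simp only [CoreSat, hc ρ ρ' fun i hi => h i (by omega), hd ρ ρ' fun i hi => h i (by omega)]
  | mem t k =>
    obtain ⟨c, hc⟩ := exists_termVal_congr (M := M) t
    refine ⟨c + k + 1, fun Z Z' ρ ρ' hZ h => ?_⟩
    simp only [CoreSat, hc ρ ρ' fun i hi => h i (by omega), hZ k (by omega)]
  | nand φ ψ ih₁ ih₂ =>
    obtain ⟨c, hc⟩ := ih₁
    obtain ⟨d, hd⟩ := ih₂
    refine ⟨c + d, fun Z Z' ρ ρ' hZ h => ?_⟩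
    simp only [CoreSat,
      hc Z Z' ρ ρ' (fun i hi => hZ i (by omega)) fun i hi => h i (by omega),
      hd Z Z' ρ ρ' (fun i hi => hZ i (by omega)) fun i hi => h i (by omega)]
  | ex φ ih =>
    obtain ⟨d, hd⟩ := ih
    refine ⟨d, fun Z Z' ρ ρ' hZ h => exists_congr fun a => hd Z Z' _ _ hZ fun i hi => ?_⟩
    cases i with
    | zero => rfl
    | succ i => exact h i (by omega)

section Comprehension

variable [hM : Fact M.RCA0]

/-- The assignment coded by the iterated pair `z = (v₀, (v₁, (v₂, …)))`. -/
noncomputable def decode (z : M.Num) : ℕ → M.Num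
  | 0 => left z
  | i + 1 => decode (right z) i

theorem decode_pair (a z : M.Num) : decode (pair a z) = cons a (decode z) := by
  funext i
  cases i <;> simp [decode, cons]

theorem exists_decode_eq (d : ℕ) (ρ : ℕ → M.Num) : ∃ z, ∀ i < d, decode z i = ρ i := by
  induction d generalizing ρ with
  | zero => exact ⟨0, fun i hi => absurd hi (by omega)⟩
  | succ d ih =>
    obtain ⟨z, hz⟩ := ih fun i => ρ (i + 1)
    refine ⟨pair (ρ 0) z, fun i hi => ?_⟩
    rw [decode_pair]
    cases i with
    | zero => rfl
    | succ i => exact hz i (by omega)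

section

variable {b : Bool} {𝒵 : Set (Set M.Num)} [Nonempty 𝒵]

theorem fn_decode (i : ℕ) (f : (ℕ → M.Num) → M.Num) [Fn b 𝒵 f] :
    Fn b 𝒵 fun ρ => decode (f ρ) i := by
  induction i generalizing f with
  | zero => exact inferInstanceAs (Fn b 𝒵 fun ρ => left (f ρ))
  | succ i ih => exact ih fun ρ => right (f ρ)

instance fn_termVal_decode (t : NumTerm) (f : (ℕ → M.Num) → M.Num) [Fn b 𝒵 f] :
    Fn b 𝒵 fun ρ => M.termVal (decode (f ρ)) t := by
  induction t with
  | var i => exact fn_decode i f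
  | zero => exact inferInstanceAs (Fn b 𝒵 fun _ => 0)
  | one => exact inferInstanceAs (Fn b 𝒵 fun _ => 1)
  | add s t ih₁ ih₂ => exact Fn.add _ _
  | mul s t ih₁ ih₂ => exact Fn.mul _ _

end

theorem isMatrix_projection {X : Set M.Num} (hX : X ∈ M.sets) :
    IsMatrix X (fun _ _ => False) fun e k _ => k ∈ X ∧ right k = e where
  mem_sets := hX
  df_prec 𝒵 _ _ := Df.of_iff (fun _ => (0 : M.Num) ≠ 0) fun _ => by simp
  df_matrix 𝒵 _ _ _ _ := inferInstance
  use _ _ _ _ _ h := h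
  trans _ _ _ h := h.elim

/-- `Σ⁰₁` comprehension: it is the recursion along the empty relation. -/
theorem Sigma0LPP.projection_mem_sets (hLPP : M.Sigma0LPP) {X : Set M.Num} (hX : X ∈ M.sets) :
    {e | ∃ a, pair a e ∈ X} ∈ M.sets := by
  obtain ⟨Y, hY, h⟩ := (isMatrix_projection hX).exists_hierarchy hLPP
    fun _ _ h j => h j fun _ h => h.elim
  convert hY
  ext e
  rw [h]
  constructor
  · rintro ⟨a, ha⟩
    exact ⟨_, ha, right_pair _ _⟩
  · rintro ⟨k, hk, rfl⟩
    exact ⟨left k, by rwa [pair_left_right]⟩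

theorem Sigma0LPP.coreSat_mem_sets (hLPP : M.Sigma0LPP) {Z : ℕ → Set M.Num}
    (hZ : ∀ k, Z k ∈ M.sets) (φ : Core) : {z | M.CoreSat Z (decode z) φ} ∈ M.sets := by
  induction φ with
  | eq s t =>
    exact setOf_mem_sets (P := fun z => M.termVal (decode z) s = M.termVal (decode z) t)
      inferInstance
  | lt s t =>
    exact setOf_mem_sets (P := fun z => M.termVal (decode z) s < M.termVal (decode z) t)
      inferInstance
  | mem t k =>
    have : SetDf true M.sets (Z k) := .of_mem (hZ k)
    exact setOf_mem_sets (P := fun z => M.termVal (decode z) t ∈ Z k) inferInstance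
  | nand φ ψ ih₁ ih₂ =>
    have := SetDf.of_mem (b := true) ih₁
    have := SetDf.of_mem (b := true) ih₂
    exact setOf_mem_sets (P := fun z => ¬ (z ∈ {z | M.CoreSat Z (decode z) φ} ∧
      z ∈ {z | M.CoreSat Z (decode z) ψ})) inferInstance
  | ex φ ih =>
    convert hLPP.projection_mem_sets ih using 1
    ext z
    simp only [CoreSat, Set.mem_ofPred_eq, decode_pair]

theorem Sigma0LPP.arithComprehension (hLPP : M.Sigma0LPP) : M.ArithComprehension := by
  intro φ ρ Z hZ
  obtain ⟨d, hd⟩ := exists_coreSat_congr (M := M) φ.toCore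
  obtain ⟨z, hz⟩ := exists_decode_eq d ρ
  have hX := hLPP.coreSat_mem_sets hZ φ.toCore
  have := SetDf.of_mem (b := true) hX
  refine ⟨_, setOf_mem_sets (P := fun n => pair n z ∈ {z | M.CoreSat Z (decode z) φ.toCore})
    inferInstance, fun n => ?_⟩
  rw [← coreSat_toCore]
  simp only [Set.mem_ofPred_eq, decode_pair]
  refine hd Z Z _ _ (fun _ _ => rfl) fun i hi => ?_
  cases i with
  | zero => rfl
  | succ i => exact hz i (by omega)

theorem Sigma0LPP.aca0 (hLPP : M.Sigma0LPP) : M.ACA0 where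
  basic := hM.out.basic
  induction X hX h0 hs := by
    have : SetDf true M.sets X := .of_mem hX
    exact delta0_induction (P := fun n => n ∈ X) inferInstance h0 hs
  comprehension := hLPP.arithComprehension

omit hM in
theorem ACA0.setOf_mem_sets (hA : M.ACA0) {P : M.Num → Prop}
    (hP : Df false M.sets fun ρ => P (ρ 0)) : {n | P n} ∈ M.sets := by
  obtain ⟨φ, Z, r, -, h₂, h₃⟩ := Df.exists_bind (Q := fun _ a => P a) hP
  obtain ⟨X, hX, h⟩ := hA.comprehension φ (env r fun _ => 0) Z h₂
  convert hX
  ext n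
  rw [h]
  exact h₃ _ n

end Comprehension

/-! ### Transfinite induction in `ACA₀` -/

section Induction

variable [hM : Fact M.RCA0]

set_option synthInstance.maxSize 1000 in
set_option synthInstance.maxHeartbeats 200000 in
/-- There is a code of the sequence `a, h a, h (h a), …` up to the index `n`. -/
theorem exists_code_iterate (h : M.Num → M.Num) [FunDf true M.sets h] (a n : M.Num) :
    ∃ s, n < left s ∧ Entry s 0 a ∧ ∀ i, i < n → ∀ v, v < s + 1 → Entry s i v →
      ∃ w, w < s + 1 ∧ h v = w ∧ Entry s (i + 1) w := by
  have hlt (x : M.Num) : x < x + 1 := (lt_add_one_iff_le _ _).2 le_rfl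
  have hdf : Df true M.sets fun ρ => ρ 1 < left (ρ 0) ∧ Entry (ρ 0) 0 a ∧ ∀ i, i < ρ 1 →
      ∀ v, v < ρ 0 + 1 → Entry (ρ 0) i v → ∃ w, w < ρ 0 + 1 ∧ h v = w ∧ Entry (ρ 0) (i + 1) w :=
    inferInstance
  refine sigma1_induction (P := fun n s => n < left s ∧ Entry s 0 a ∧ ∀ i, i < n →
    ∀ v, v < s + 1 → Entry s i v → ∃ w, w < s + 1 ∧ h v = w ∧ Entry s (i + 1) w)
    hdf ?_ (fun n ⟨s, hn, h0, hs⟩ => ?_) n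
  · have : FunDf true M.sets fun _ : M.Num => a := ⟨(inferInstance : Df true _ fun ρ => a = ρ 1)⟩
    obtain ⟨s, -, hlen, hs⟩ := exists_code (fun _ => a) (0 + 1)
    exact ⟨s, hlen ▸ hlt 0, (hs 0 a).2 ⟨hlt 0, rfl⟩, fun i hi => (not_lt.2 zero_le hi).elim⟩
  · obtain ⟨c, hc⟩ := Entry.exists hn
    have hex (i : M.Num) : ∃ v, (i < n + 1 ∧ Entry s i v) ∨ (¬ i < n + 1 ∧ v = h c) := by
      by_cases hi : i < n + 1
      · obtain ⟨v, hv⟩ := Entry.exists (((lt_add_one_iff_le _ _).1 hi).trans_lt hn)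
        exact ⟨v, .inl ⟨hi, hv⟩⟩
      · exact ⟨h c, .inr ⟨hi, rfl⟩⟩
    choose f hf using hex
    have hle {i v : M.Num} (hi : i < n + 1) : f i = v ↔ Entry s i v := by
      rcases hf i with ⟨-, h'⟩ | ⟨h', -⟩
      · exact ⟨fun h => h ▸ h', fun h => h'.unique h⟩
      · exact (h' hi).elim
    have hgt {i : M.Num} (hi : ¬ i < n + 1) : f i = h c := by
      rcases hf i with ⟨h', -⟩ | ⟨-, h'⟩
      exacts [(hi h').elim, h']
    have : FunDf true M.sets f := by
      refine ⟨.of_iff (fun ρ => (ρ 0 < n + 1 ∧ Entry s (ρ 0) (ρ 1)) ∨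
        (¬ ρ 0 < n + 1 ∧ ρ 1 = h c)) fun ρ => ?_⟩
      by_cases hi : ρ 0 < n + 1
      · simp only [hi, hle hi, true_and, not_true, false_and, or_false]
      · simp only [hi, hgt hi, false_and, not_false_iff, true_and, false_or, eq_comm]
    obtain ⟨t, -, hlen, ht⟩ := exists_code f (n + 1 + 1)
    have hpos : (0 : M.Num) < n + 1 := by positivity
    refine ⟨t, hlen ▸ hlt _, (ht 0 a).2 ⟨hpos.trans (hlt _), (hle hpos).2 h0⟩,
      fun i hi v hv hiv => ?_⟩
    rw [ht, hle hi] at hiv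
    have key : Entry t (i + 1) (h v) := by
      rw [ht]
      refine ⟨by simpa using hi, ?_⟩
      rcases ((lt_add_one_iff_le _ _).1 hi).lt_or_eq with hi' | rfl
      · rw [hle (by simpa using hi')]
        obtain ⟨w, -, rfl, hw⟩ := hs i hi' v ((lt_add_one_iff_le _ _).2 hiv.2.le) hiv.2
        exact hw
      · rw [hgt (lt_irrefl _), hc.unique hiv.2]
    exact ⟨_, (lt_add_one_iff_le _ _).2 key.le, rfl, key⟩

/-- Functions can be iterated in a model of `ACA₀`. -/
theorem ACA0.exists_iterate (hA : M.ACA0) (h : M.Num → M.Num) (hh : graph h ∈ M.sets)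
    (a : M.Num) : ∃ f, graph f ∈ M.sets ∧ f 0 = a ∧ ∀ n, f (n + 1) = h (f n) := by
  have hlt (x : M.Num) : x < x + 1 := (lt_add_one_iff_le _ _).2 le_rfl
  have : FunDf true M.sets h := .of_graph_mem hh
  have : FunDf false M.sets h := .of_graph (.of_mem hh)
  choose s hlen h0 hs using exists_code_iterate h a
  have hstep {n i v : M.Num} (hi : i < n) (hv : Entry (s n) i v) : Entry (s n) (i + 1) (h v) := by
    obtain ⟨w, -, rfl, hw⟩ := hs n i hi v ((lt_add_one_iff_le _ _).2 hv.le) hv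
    exact hw
  have hagree (n m i : M.Num) : i ≤ n → i ≤ m → ∀ v, v < s n + 1 →
      Entry (s n) i v → Entry (s m) i v := by
    refine delta0_induction (P := fun i => i ≤ n → i ≤ m → ∀ v, v < s n + 1 →
      Entry (s n) i v → Entry (s m) i v) inferInstance ?_ (fun i ih hn hm v _ hv => ?_) i
    · intro _ _ v _ hv
      rw [hv.unique (h0 n)]
      exact h0 m
    · rw [add_one_le_iff_lt] at hn hm
      obtain ⟨c, hc⟩ := Entry.exists (hn.trans (hlen n))
      rw [hv.unique (hstep hn hc)]
      exact hstep hm (ih hn.le hm.le c ((lt_add_one_iff_le _ _).2 hc.le) hc)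
  choose f hf using fun n => Entry.exists (hlen n)
  have hval {n t : M.Num} (ht : n < left t ∧ Entry t 0 a ∧ ∀ i, i < n → ∀ v, v < t + 1 →
      Entry t i v → ∃ w, w < t + 1 ∧ h v = w ∧ Entry t (i + 1) w) : Entry t n (f n) := by
    have key (i : M.Num) : i ≤ n → ∀ v, v < s n + 1 → Entry (s n) i v → Entry t i v := by
      refine delta0_induction (P := fun i => i ≤ n → ∀ v, v < s n + 1 →
        Entry (s n) i v → Entry t i v) inferInstance ?_ (fun i ih hn v _ hv => ?_) i
      · intro _ v _ hv
        rw [hv.unique (h0 n)]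
        exact ht.2.1
      · rw [add_one_le_iff_lt] at hn
        obtain ⟨c, hc⟩ := Entry.exists (hn.trans (hlen n))
        have hc' := ih hn.le c ((lt_add_one_iff_le _ _).2 hc.le) hc
        obtain ⟨w, -, hw, hw'⟩ := ht.2.2 i hn c ((lt_add_one_iff_le _ _).2 hc'.le) hc'
        rwa [hv.unique (hstep hn hc), hw]
    exact key n le_rfl _ ((lt_add_one_iff_le _ _).2 (hf n).le) (hf n)
  refine ⟨f, ?_, (hf 0).unique (h0 0), fun n => ?_⟩
  · have hdf : Df false M.sets fun ρ => ∃ t, (left (ρ 0) < left t ∧ Entry t 0 a ∧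
        ∀ i, i < left (ρ 0) → ∀ v, v < t + 1 → Entry t i v →
          ∃ w, w < t + 1 ∧ h v = w ∧ Entry t (i + 1) w) ∧ Entry t (left (ρ 0)) (right (ρ 0)) :=
      inferInstance
    convert hA.setOf_mem_sets (P := fun p => ∃ t, (left p < left t ∧ Entry t 0 a ∧
        ∀ i, i < left p → ∀ v, v < t + 1 → Entry t i v →
          ∃ w, w < t + 1 ∧ h v = w ∧ Entry t (i + 1) w) ∧ Entry t (left p) (right p)) hdf using 1
    ext p
    constructor
    · intro hp
      exact ⟨s (left p), ⟨hlen _, h0 _, hs _⟩, (show f (left p) = right p from hp) ▸ hf _⟩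
    · rintro ⟨t, ht, hp⟩
      exact (hval ht).unique hp
  · have h₁ := hstep (hlt n) (hagree n (n + 1) n le_rfl (hlt n).le _
      ((lt_add_one_iff_le _ _).2 (hf n).le) (hf n))
    exact (hf (n + 1)).unique h₁

/-- In a model of `ACA₀`, a well-ordering has no nonempty set without minimal element. -/
theorem ACA0.exists_minimal (hA : M.ACA0) {R : Set M.Num} (hR : WO R) {S : Set M.Num}
    (hS : S ∈ M.sets) (hne : S.Nonempty) : ∃ i ∈ S, ∀ j ∈ S, pair j i ∉ R := by
  by_contra! hcon
  have hRs := hR.1.mem_sets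
  have : SetDf true M.sets R := .of_mem hRs
  have : SetDf true M.sets S := .of_mem hS
  have : SetDf false M.sets S := .of_mem hS
  have hex (i : M.Num) : ∃ j, (i ∈ S ∧ (j ∈ S ∧ pair j i ∈ R) ∧
      ∀ k, k < j → ¬ (k ∈ S ∧ pair k i ∈ R)) ∨ (i ∉ S ∧ j = 0) := by
    by_cases hi : i ∈ S
    · obtain ⟨j, hj, hj'⟩ := delta0_exists_least (P := fun j => j ∈ S ∧ pair j i ∈ R) inferInstance
        (hcon i hi)
      exact ⟨j, .inl ⟨hi, hj, hj'⟩⟩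
    · exact ⟨0, .inr ⟨hi, rfl⟩⟩
  choose h hh using hex
  have : FunDf true M.sets h := by
    refine ⟨.of_iff (fun ρ => (ρ 0 ∈ S ∧ (ρ 1 ∈ S ∧ pair (ρ 1) (ρ 0) ∈ R) ∧
      ∀ k, k < ρ 1 → ¬ (k ∈ S ∧ pair k (ρ 0) ∈ R)) ∨ (ρ 0 ∉ S ∧ ρ 1 = 0)) fun ρ => ?_⟩
    constructor
    · intro h'
      exact h' ▸ hh (ρ 0)
    · rcases hh (ρ 0) with ⟨h₁, h₂, h₃⟩ | ⟨h₁, h₂⟩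
      · rintro (⟨-, h₂', h₃'⟩ | ⟨h, -⟩)
        · rcases lt_trichotomy (h (ρ 0)) (ρ 1) with h | h | h
          exacts [(h₃' _ h h₂).elim, h, (h₃ _ h h₂').elim]
        · exact (h h₁).elim
      · rintro (⟨h, -⟩ | ⟨-, h⟩)
        · exact (h₁ h).elim
        · exact h₂.trans h.symm
  obtain ⟨a, ha⟩ := hne
  obtain ⟨f, hf, hf0, hfs⟩ := hA.exists_iterate h (graph_mem_sets h) a
  have hhS {i : M.Num} (hi : i ∈ S) : h i ∈ S ∧ pair (h i) i ∈ R := by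
    rcases hh i with ⟨-, h, -⟩ | ⟨h, -⟩
    exacts [h, (h hi).elim]
  have : FunDf false M.sets f := .of_graph (.of_mem hf)
  have hset : {n | ∃ v, f n = v ∧ v ∈ S} ∈ M.sets :=
    hA.setOf_mem_sets (P := fun n => ∃ v, f n = v ∧ v ∈ S) inferInstance
  have hfS (n : M.Num) : f n ∈ S := by
    obtain ⟨_, rfl, hv⟩ := hA.induction _ hset ⟨_, rfl, hf0 ▸ ha⟩
      (fun n ⟨v, hv, hvS⟩ => ⟨_, rfl, by rw [hfs, hv]; exact (hhS hvS).1⟩) n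
    exact hv
  refine hR.2 ⟨graph f, isFun_graph hf, fun i x y hx hy => ?_⟩
  rw [pairMem_graph] at hx hy
  subst hx hy
  rw [pairMem_iff, hfs]
  exact (hhS (hfS i)).2

/-- The lexicographic product of the relation `R` with the ordering of the numbers. -/
def lexPrec (R : Set M.Num) (a c : M.Num) : Prop :=
  pair (left a) (left c) ∈ R ∨ (left a = left c ∧ right a < right c)

/-- Given a counterexample, choose first a minimal left component and then the least right one. -/
theorem ACA0.arithInduction_lexPrec (hA : M.ACA0) {R : Set M.Num} (hR : WO R) :
    M.ArithInduction (lexPrec R) := by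
  intro Q hQ hprog j
  by_contra hj
  have hS : {n | ¬ Q n} ∈ M.sets := hA.setOf_mem_sets (P := fun n => ¬ Q n) inferInstance
  set S := {n | ¬ Q n}
  have : SetDf false M.sets S := .of_mem hS
  have : SetDf true M.sets S := .of_mem hS
  obtain ⟨i, ⟨l, hl⟩, hi⟩ := hA.exists_minimal hR
    (hA.setOf_mem_sets (P := fun i => ∃ l, pair i l ∈ S) inferInstance)
    ⟨left j, right j, by rw [pair_left_right]; exact hj⟩
  obtain ⟨l, hl, hmin⟩ := delta0_exists_least (P := fun l => pair i l ∈ S) inferInstance ⟨l, hl⟩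
  refine hl (hprog _ fun c hc => ?_)
  by_contra hcQ
  unfold lexPrec at hc
  rw [left_pair, right_pair] at hc
  rcases hc with hc | ⟨rfl, hc⟩
  · exact hi (left c) ⟨right c, by rw [pair_left_right]; exact hcQ⟩ hc
  · exact hmin _ hc (by rw [pair_left_right]; exact hcQ)

end Induction

end L2Structure

/-! ### Arithmetical transfinite recursion -/

/-- An injective numbering of the terms. -/
def NumTerm.code : NumTerm → ℕ
  | var i => 5 * i
  | zero => 1
  | one => 2
  | add s t => 5 * Nat.pair s.code t.code + 3
  | mul s t => 5 * Nat.pair s.code t.code + 4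

theorem NumTerm.code_injective : Function.Injective NumTerm.code := by
  intro s
  induction s with
  | var i => intro t h; cases t <;> simp only [code] at h <;> first | omega | congr; omega
  | zero => intro t h; cases t <;> simp only [code] at h <;> first | omega | rfl
  | one => intro t h; cases t <;> simp only [code] at h <;> first | omega | rfl
  | add s₁ s₂ ih₁ ih₂ =>
    intro t h
    cases t <;> simp only [code] at h <;> try omega
    simp only [Nat.add_right_cancel_iff, Nat.mul_right_inj (show 5 ≠ 0 by decide),
      Nat.pair_eq_pair] at h
    rw [ih₁ h.1, ih₂ h.2]
  | mul s₁ s₂ ih₁ ih₂ =>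
    intro t h
    cases t <;> simp only [code] at h <;> try omega
    simp only [Nat.add_right_cancel_iff, Nat.mul_right_inj (show 5 ≠ 0 by decide),
      Nat.pair_eq_pair] at h
    rw [ih₁ h.1, ih₂ h.2]

/-- An injective numbering of the core formulas in which subformulas have smaller numbers. -/
def Core.code : Core → ℕ
  | eq s t => 5 * Nat.pair s.code t.code
  | lt s t => 5 * Nat.pair s.code t.code + 1
  | mem t k => 5 * Nat.pair t.code k + 2
  | nand φ ψ => 5 * Nat.pair φ.code ψ.code + 3
  | ex φ => 5 * φ.code + 4

theorem Core.code_injective : Function.Injective Core.code := by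
  intro φ
  induction φ with
  | eq s t | lt s t =>
    intro ψ h
    cases ψ <;> simp only [code] at h <;> try omega
    simp only [Nat.add_right_cancel_iff, Nat.mul_right_inj (show 5 ≠ 0 by decide),
      Nat.pair_eq_pair] at h
    rw [NumTerm.code_injective h.1, NumTerm.code_injective h.2]
  | mem t k =>
    intro ψ h
    cases ψ <;> simp only [code] at h <;> try omega
    simp only [Nat.add_right_cancel_iff, Nat.mul_right_inj (show 5 ≠ 0 by decide),
      Nat.pair_eq_pair] at h
    rw [NumTerm.code_injective h.1, h.2]
  | nand φ₁ φ₂ ih₁ ih₂ =>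
    intro ψ h
    cases ψ <;> simp only [code] at h <;> try omega
    simp only [Nat.add_right_cancel_iff, Nat.mul_right_inj (show 5 ≠ 0 by decide),
      Nat.pair_eq_pair] at h
    rw [ih₁ h.1, ih₂ h.2]
  | ex φ ih =>
    intro ψ h
    cases ψ <;> simp only [code] at h <;> try omega
    simp only [Nat.add_right_cancel_iff, Nat.mul_right_inj (show 5 ≠ 0 by decide)] at h
    rw [ih h]

theorem Core.code_left_lt_nand (φ ψ : Core) : φ.code < (nand φ ψ).code := by
  have := Nat.left_le_pair φ.code ψ.code
  simp only [code]
  omega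

theorem Core.code_right_lt_nand (φ ψ : Core) : ψ.code < (nand φ ψ).code := by
  have := Nat.right_le_pair φ.code ψ.code
  simp only [code]
  omega

theorem Core.code_lt_ex (φ : Core) : φ.code < (ex φ).code := by
  simp only [code]
  omega

/-- The subformulas of a core formula. -/
def Core.subs : Core → List Core
  | eq s t => [eq s t]
  | lt s t => [lt s t]
  | mem t k => [mem t k]
  | nand φ ψ => nand φ ψ :: (φ.subs ++ ψ.subs)
  | ex φ => ex φ :: φ.subs

theorem Core.self_mem_subs (φ : Core) : φ ∈ φ.subs := by
  cases φ <;> simp [subs]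

theorem Core.mem_subs_of_nand {φ ψ χ : Core} (h : nand φ ψ ∈ χ.subs) :
    φ ∈ χ.subs ∧ ψ ∈ χ.subs := by
  induction χ with
  | eq | lt | mem => simp [subs] at h
  | nand χ₁ χ₂ ih₁ ih₂ =>
    simp only [subs, List.mem_cons, nand.injEq, List.mem_append] at h ⊢
    rcases h with ⟨rfl, rfl⟩ | h | h
    · exact ⟨.inr (.inl φ.self_mem_subs), .inr (.inr ψ.self_mem_subs)⟩
    · exact ⟨.inr (.inl (ih₁ h).1), .inr (.inl (ih₁ h).2)⟩
    · exact ⟨.inr (.inr (ih₂ h).1), .inr (.inr (ih₂ h).2)⟩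
  | ex χ ih =>
    simp only [subs, List.mem_cons, reduceCtorEq, false_or] at h ⊢
    exact ⟨.inr (ih h).1, .inr (ih h).2⟩

theorem Core.mem_subs_of_ex {φ χ : Core} (h : ex φ ∈ χ.subs) : φ ∈ χ.subs := by
  induction χ with
  | eq | lt | mem => simp [subs] at h
  | nand χ₁ χ₂ ih₁ ih₂ =>
    simp only [subs, List.mem_cons, reduceCtorEq, false_or, List.mem_append] at h ⊢
    exact .inr (h.imp ih₁ ih₂)
  | ex χ ih =>
    simp only [subs, List.mem_cons, ex.injEq] at h ⊢
    rcases h with rfl | h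
    · exact .inr φ.self_mem_subs
    · exact .inr (ih h)

namespace L2Structure

variable {M : L2Structure.{u}}

section Recursion

variable [hM : Fact M.RCA0]

/-- The number that stands for the statement that the formula `φ` holds of the assignment coded by
`z` and the part of the hierarchy below `j`. Its level is the pair of `j` and the code of `φ`. -/
noncomputable def truthCode (φ : Core) (z j : M.Num) : M.Num := pair z (pair j (φ.code : M.Num))

/-- How the truth of a formula, on the level `j = left (right e)` and under the assignment
`z = left e`, is obtained with the witness `k` from the set `X` of true statements of lower levels.
The set `P` codes the relation `R` and the set parameters; the variable `X₀` stands for the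
elements `(x, i)` with `i` below `j` for which `χ` is true on level `i` under the assignment
`(x, c)`. -/
def TruthStep (χ : Core) (c : M.Num) (P : Set M.Num) :
    Core → M.Num → M.Num → Set M.Num → Prop
  | .eq s t, e, _, _ => M.termVal (decode (left e)) s = M.termVal (decode (left e)) t
  | .lt s t, e, _, _ => M.termVal (decode (left e)) s < M.termVal (decode (left e)) t
  | .mem t 0, e, k, X =>
    pair 0 (pair (right (M.termVal (decode (left e)) t)) (left (right e))) ∈ P ∧
      truthCode χ (pair (left (M.termVal (decode (left e)) t)) c)
        (right (M.termVal (decode (left e)) t)) < k ∧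
      truthCode χ (pair (left (M.termVal (decode (left e)) t)) c)
        (right (M.termVal (decode (left e)) t)) ∈ X
  | .mem t (i + 1), e, _, _ => pair ((i + 1 : ℕ) : M.Num) (M.termVal (decode (left e)) t) ∈ P
  | .nand φ ψ, e, k, X =>
    truthCode φ (left e) (left (right e)) < k ∧ truthCode ψ (left e) (left (right e)) < k ∧
      ¬ (truthCode φ (left e) (left (right e)) ∈ X ∧ truthCode ψ (left e) (left (right e)) ∈ X)
  | .ex φ, e, k, X => ∃ a, a < k ∧ truthCode φ (pair a (left e)) (left (right e)) < k ∧
      truthCode φ (pair a (left e)) (left (right e)) ∈ X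

/-- The matrix of the recursion that evaluates all subformulas of `χ` along `R`. -/
def TruthMatrix (χ : Core) (c : M.Num) (P : Set M.Num) (e k : M.Num) (X : Set M.Num) : Prop :=
  ∃ φ ∈ χ.subs, right (right e) = (φ.code : M.Num) ∧ TruthStep χ c P φ e k X

theorem Df.exists_mem_list {b : Bool} {𝒵 : Set (Set M.Num)} [Nonempty 𝒵] {A : Type*} (l : List A)
    {Q : A → (ℕ → M.Num) → Prop} (hQ : ∀ x, Df b 𝒵 (Q x)) : Df b 𝒵 fun ρ => ∃ x ∈ l, Q x ρ := by
  induction l with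
  | nil => exact .of_iff (fun _ => (0 : M.Num) ≠ 0) fun _ => by simp
  | cons x l ih =>
    have := hQ x
    exact .of_iff (fun ρ => Q x ρ ∨ ∃ x ∈ l, Q x ρ) fun _ => by simp

theorem isMatrix_truthMatrix (χ : Core) (c : M.Num) {P R : Set M.Num} (hP : P ∈ M.sets)
    (hPR : ∀ x, pair 0 x ∈ P ↔ x ∈ R) (hR : IsLinearOrdering R) :
    IsMatrix P (lexPrec R) (TruthMatrix χ c P) where
  mem_sets := hP
  df_prec 𝒵 _ _ := .of_iff (fun ρ => pair 0 (pair (left (ρ 0)) (left (ρ 1))) ∈ P ∨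
    (left (ρ 0) = left (ρ 1) ∧ right (ρ 0) < right (ρ 1))) fun ρ => by rw [hPR]; rfl
  df_matrix 𝒵 _ _ X hX := by
    refine Df.exists_mem_list _ fun φ => ?_
    have h₁ (f : (ℕ → M.Num) → M.Num) [Fn true 𝒵 f] : Df true 𝒵 fun ρ => f ρ ∈ X ρ :=
      Df.subst (Q := fun ρ a => a ∈ X ρ) f hX
    have hX' : Df true 𝒵 fun ρ => ρ 0 ∈ X fun n => ρ (n + 2) :=
      hX.comp_env fun | 0 => .inl 0 | i + 1 => .inl (i + 2)
    have h₂ (f : (ℕ → M.Num) → M.Num) [Fn true 𝒵 f] :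
        Df true 𝒵 fun ρ => f ρ ∈ X fun n => ρ (n + 1) :=
      Df.subst (Q := fun ρ a => a ∈ X fun n => ρ (n + 1)) f hX'
    have h₃ : Df true 𝒵 fun ρ => TruthStep χ c P φ (ρ 0) (ρ 1) (X ρ) := by
      cases φ with
      | mem t i => cases i <;> (unfold TruthStep truthCode; infer_instance)
      | eq | lt | nand | ex => unfold TruthStep; try unfold truthCode
                               infer_instance
    infer_instance
  use := by
    rintro e k X X' h ⟨φ, hφ, he, hs⟩
    refine ⟨φ, hφ, he, ?_⟩
    cases φ with
    | eq | lt => exact hs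
    | mem t i =>
      cases i with
      | zero => exact ⟨hs.1, hs.2.1, (h _ hs.2.1).1 hs.2.2⟩
      | succ i => exact hs
    | nand φ ψ =>
      refine ⟨hs.1, hs.2.1, ?_⟩
      rw [← h _ hs.1, ← h _ hs.2.1]
      exact hs.2.2
    | ex φ =>
      obtain ⟨a, ha, ha', h'⟩ := hs
      exact ⟨a, ha, ha', (h _ ha').1 h'⟩
  trans := by
    have htrans (x y z : M.Num) (h : pair x y ∈ R) (h' : pair y z ∈ R) : pair x z ∈ R :=
      pairMem_iff.1 (hR.trans x y z (pairMem_iff.2 h) (pairMem_iff.2 h'))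
    rintro i j k (h | ⟨h, h'⟩) (h₁ | ⟨h₁, h₁'⟩)
    · exact .inl (htrans _ _ _ h h₁)
    · exact .inl (h₁ ▸ h)
    · exact .inl (h ▸ h₁)
    · exact .inr ⟨h.trans h₁, h'.trans h₁'⟩

/-- The hierarchy for the formula `χ` that is extracted from the set `Y` of true statements. -/
def truthSet (χ : Core) (c : M.Num) (Y : Set M.Num) : Set M.Num :=
  {p | truthCode χ (pair (left p) c) (right p) ∈ Y}

/-- A hierarchy `Y` for the truth matrix evaluates all subformulas of `χ` correctly, where the
variable `X₀` stands for the part below `j` of the hierarchy that is extracted from `Y` itself. -/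
theorem mem_truthCode_iff {χ : Core} {c : M.Num} {P R Y : Set M.Num} {Z : ℕ → Set M.Num}
    (hPR : ∀ x, pair 0 x ∈ P ↔ x ∈ R)
    (hPZ : ∀ (i : ℕ) (x : M.Num), pair ((i + 1 : ℕ) : M.Num) x ∈ P ↔ x ∈ Z i)
    (hY : ∀ e, e ∈ Y ↔ ∃ k, TruthMatrix χ c P e k (restrict (lexPrec R) Y (right e)))
    {φ : Core} (hφ : φ ∈ χ.subs) (z j : M.Num) :
    truthCode φ z j ∈ Y ↔
      M.CoreSat (cons (below R (truthSet χ c Y) j) Z) (decode z) φ := by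
  have hstep {φ : Core} (hφ : φ ∈ χ.subs) (z j : M.Num) : truthCode φ z j ∈ Y ↔
      ∃ k, TruthStep χ c P φ (truthCode φ z j) k
        (restrict (lexPrec R) Y (pair j (φ.code : M.Num))) := by
    rw [hY]
    refine exists_congr fun k => ?_
    simp only [truthCode, right_pair]
    constructor
    · rintro ⟨ψ, -, h, hs⟩
      rw [right_pair, right_pair, Nat.cast_inj] at h
      obtain rfl := Core.code_injective h
      exact hs
    · intro hs
      exact ⟨φ, hφ, by simp, hs⟩
  have hlt (x : M.Num) : x < x + 1 := (lt_add_one_iff_le _ _).2 le_rfl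
  have hmem {φ ψ : Core} (h : φ.code < ψ.code) (z j : M.Num) :
      truthCode φ z j ∈ restrict (lexPrec R) Y (pair j (ψ.code : M.Num)) ↔ truthCode φ z j ∈ Y := by
    -- Both statements are on the same level `j` of `R`, and the code of `φ` is smaller.
    refine and_iff_left (.inr ?_)
    simpa [truthCode] using h
  induction φ generalizing z j with
  | eq s t | lt s t =>
    rw [hstep hφ]
    simp [TruthStep, CoreSat, truthCode]
  | mem t i =>
    cases i with
    | zero =>
      rw [hstep hφ]
      simp only [TruthStep, CoreSat, cons, below, hPR, truthSet, Set.mem_ofPred_eq, isPair_iff,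
        pairMem_iff]
      simp only [truthCode, left_pair, right_pair]
      set v := M.termVal (decode z) t
      constructor
      · rintro ⟨k, h₁, -, h₂, -⟩
        exact ⟨h₂, left v, right v, (pair_left_right v).symm, h₁⟩
      · rintro ⟨h₁, m, i, hv, h₂⟩
        obtain ⟨-, rfl⟩ := eq_pair_iff.1 hv
        exact ⟨_, h₂, hlt _, h₁, .inl (by simpa using h₂)⟩
    | succ i =>
      rw [hstep hφ]
      simp only [TruthStep, CoreSat, cons, hPZ, exists_const]
      simp only [truthCode, left_pair]
  | nand φ ψ ih₁ ih₂ =>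
    obtain ⟨h₁, h₂⟩ := Core.mem_subs_of_nand hφ
    replace ih₁ : truthCode φ z j ∈ Y ↔ _ := ih₁ h₁ z j
    replace ih₂ : truthCode ψ z j ∈ Y ↔ _ := ih₂ h₂ z j
    rw [hstep hφ, CoreSat, ← ih₁, ← ih₂, ← hmem (Core.code_left_lt_nand φ ψ),
      ← hmem (Core.code_right_lt_nand φ ψ)]
    simp only [TruthStep]
    have e₁ : left (truthCode (.nand φ ψ) z j) = z := left_pair _ _
    have e₂ : left (right (truthCode (.nand φ ψ) z j)) = j := by simp [truthCode]
    rw [e₁, e₂]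
    constructor
    · rintro ⟨k, -, -, h⟩
      exact h
    · intro h
      exact ⟨truthCode φ z j + truthCode ψ z j + 1, (lt_add_one_iff_le _ _).2 le_self_add,
        (lt_add_one_iff_le _ _).2 le_add_self, h⟩
  | ex φ ih =>
    have h₁ := Core.mem_subs_of_ex hφ
    rw [hstep hφ, CoreSat]
    simp only [← decode_pair, ← ih h₁, ← hmem (Core.code_lt_ex φ)]
    simp only [TruthStep]
    have e₁ : left (truthCode (.ex φ) z j) = z := left_pair _ _
    have e₂ : left (right (truthCode (.ex φ) z j)) = j := by simp [truthCode]
    rw [e₁, e₂]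
    constructor
    · rintro ⟨k, a, -, -, h⟩
      exact ⟨a, h⟩
    · rintro ⟨a, h⟩
      exact ⟨a + truthCode φ (pair a z) j + 1, a, (lt_add_one_iff_le _ _).2 le_self_add,
        (lt_add_one_iff_le _ _).2 le_add_self, h⟩

/-- Finitely many sets can be coded by one. -/
theorem exists_coded_family {R : Set M.Num} (hR : R ∈ M.sets) {Z : ℕ → Set M.Num}
    (hZ : ∀ k, Z k ∈ M.sets) (d : ℕ) : ∃ P ∈ M.sets, (∀ x, pair 0 x ∈ P ↔ x ∈ R) ∧
      ∀ (i : ℕ) (x : M.Num), pair ((i + 1 : ℕ) : M.Num) x ∈ P ↔ i < d ∧ x ∈ Z i := by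
  induction d with
  | zero =>
    have : SetDf true M.sets R := .of_mem hR
    refine ⟨_, setOf_mem_sets (P := fun p => left p = 0 ∧ right p ∈ R) inferInstance, ?_, ?_⟩
    · simp
    · intro i x
      simp only [Set.mem_ofPred_eq, left_pair, Nat.cast_eq_zero]
      simp
  | succ d ih =>
    obtain ⟨P, hP, h₁, h₂⟩ := ih
    have : SetDf true M.sets P := .of_mem hP
    have : SetDf true M.sets (Z d) := .of_mem (hZ d)
    refine ⟨_, setOf_mem_sets (P := fun p => p ∈ P ∨
      (left p = ((d + 1 : ℕ) : M.Num) ∧ right p ∈ Z d)) inferInstance, fun x => ?_, fun i x => ?_⟩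
    · have : (0 : M.Num) ≠ ((d + 1 : ℕ) : M.Num) := by
        rw [← Nat.cast_zero, Ne, Nat.cast_inj]
        omega
      simp only [Set.mem_ofPred_eq, left_pair, h₁, this, false_and, or_false]
    · simp only [Set.mem_ofPred_eq, left_pair, right_pair, h₂, Nat.cast_inj]
      constructor
      · rintro (⟨h, h'⟩ | ⟨h, h'⟩)
        · exact ⟨by omega, h'⟩
        · obtain rfl : i = d := by omega
          exact ⟨by omega, h'⟩
      · rintro ⟨h, h'⟩
        rcases Nat.lt_succ_iff_lt_or_eq.1 h with h | rfl
        · exact .inl ⟨h, h'⟩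
        · exact .inr ⟨rfl, h'⟩

theorem Sigma0LPP.arithTransfiniteRecursion (hLPP : M.Sigma0LPP) :
    M.ArithTransfiniteRecursion := by
  intro θ ρ Z hZ R hR
  set χ := θ.toCore with hχ
  obtain ⟨d, hd⟩ := exists_coreSat_congr (M := M) χ
  obtain ⟨c, hc⟩ := exists_decode_eq d ρ
  obtain ⟨P, hP, hPR, hPZ⟩ := exists_coded_family hR.1.mem_sets hZ d
  obtain ⟨Y, hY, hYe⟩ := (isMatrix_truthMatrix χ c hP hPR hR.1).exists_hierarchy hLPP
    (hLPP.aca0.arithInduction_lexPrec hR)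
  have : SetDf true M.sets Y := .of_mem hY
  refine ⟨truthSet χ c Y, setOf_mem_sets
    (P := fun p => pair (pair (left p) c) (pair (right p) (χ.code : M.Num)) ∈ Y) inferInstance,
    fun j _ x => ?_⟩
  have key := mem_truthCode_iff (Z := fun i => {x | i < d ∧ x ∈ Z i}) hPR hPZ hYe
    χ.self_mem_subs (pair x c) j
  rw [pairMem_iff, ← coreSat_toCore, ← hχ]
  refine Iff.trans ?_ (key.trans (hd _ _ _ _ (fun i hi => ?_) fun i hi => ?_))
  · simp only [truthSet, Set.mem_ofPred_eq, left_pair, right_pair]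
  · cases i with
    | zero => rfl
    | succ i =>
      ext x
      exact and_iff_right (by omega)
  · rw [decode_pair]
    cases i with
    | zero => rfl
    | succ i => exact hc i (by omega)

end Recursion

end L2Structure

end SOA

theorem mainTheorem4 (M : SOA.L2Structure.{u}) (hM : M.RCA0) (hLPP : M.Sigma0LPP) : M.ATR0 := by
  have : Fact M.RCA0 := ⟨hM⟩
  exact ⟨hLPP.aca0, hLPP.arithTransfiniteRecursion⟩
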